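/- **Setting.** Let $m,n\ge 1$ and $d_1,\dots,d_m,K_1,\dots,K_n\ge 1$ be integers, $[k]:=\{1,\dots,k\}$. A Bayesian latent variable model has global latent variables $\theta=(\theta_1,\dots,\theta_m)$, $\theta_j\in\mathbb R^{d_j}$, and categorical local latent variables $Z=(Z_1,\dots,Z_n)$, $Z_i\in[K_i]$. Let $\mathcal M=\prod_j\mathcal M_{g,j}\otimes\prod_i\mathcal M_{l,i}$ be a product of $\sigma$-finite base measures on $\prod_j\mathbb R^{d_j}\times\prod_i[K_i]$, let $p(\theta,z)$ be the prior density with respect to $\mathcal M$, and let $L(X\mid\theta,z)$ be the likelihood of the observed data $X$ (fixed), with $0<\int pL\,d\mathcal M<\infty$. The posterior $\mathbb P(\theta,Z\mid X)$ is the probability measure with $\mathcal M$-density proportional to $p(\theta,z)L(X\mid\theta,z)$. Let $\mathcal P$ be the set of probability measures with $\mathcal M$-density of the form $\prod_j\xi_j(\theta_j)\prod_i\zeta_i(z_i)$, where $\xi_j,\zeta_i$ are probability densities with respect to $\mathcal M_{g,j},\mathcal M_{l,i}$, and let $\hat P\in\arg\min_{P\in\mathcal P}\mathrm D_{\mathrm{KL}}(P\,\|\,\mathbb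 P(\theta,Z\mid X))$ (the minimum is assumed to be attained). Let $\nu=\nu_1\otimes\dots\otimes\nu_m$ and $\mu=\mu_1\otimes\dots\otimes\mu_n$, where $\nu_j$ is a probability measure on $\mathbb R^{d_j}$ and $\mu_i$ one on $[K_i]$. Write $\mathcal C:=\prod_i[0,1]^{K_i}$, $\hat{\mathcal Y}:=\{y\in\mathcal C:\sum_\ell y_{i,\ell}=1\ \forall i\}$, and let $G(z)\in\hat{\mathcal Y}$, $G_{i,\ell}(z)=\mathbb 1_{z_i=\ell}$, be the one-hot encoding. A function is called $C^2$ on $\mathcal C$ if it is twice continuously differentiable in the interior and it and its derivatives of order $\le2$ extend continuously to $\mathcal C$ (derivatives at boundary points denote these extensions). **Assumptions.** 1. $\dfrac{d\,\mathbb P(\theta,Z\mid X)}{d(\nu\otimes\mu)}\propto e^{r(\theta,z)}$, where $r(\theta,z)=r_0(z)+\sum_{j=1}^m r_j(\theta_j,z)$ is real-valued. 2. There is a real-valued $R(\theta,y)=R_0(y)+\sum_{j=1}^mR_j(\theta_j,y)$ on $\prod_j\mathbb R^{d_j}\times\mathcal C$ such that, for every $\theta$, $R(\theta,\cdot)$ is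 $C^2$ on $\mathcal C$ and $R(\theta,G(z))=r(\theta,z)$ for all $z$. (Each $r_j(\cdot,z)$, and each $R_j(\cdot,y)$ with $y\in\hat{\mathcal Y}$, is measurable.) 3. $F:\mathcal C\to\mathbb R$ is $C^2$ on $\mathcal C$ and $F(y)=\log\int e^{R(\theta,y)}\,d\nu(\theta)$ (with a finite integral) for all $y\in\hat{\mathcal Y}$. **Notation.** $f(z):=\log\int e^{r(\theta,z)}d\nu(\theta)$, $S:=\sum_z e^{f(z)}\mu(z)$, and, for $y\in\hat{\mathcal Y}$, $I(y):=\sum_{i,\ell}y_{i,\ell}\log\frac{y_{i,\ell}}{\mu_i(\ell)}\in[0,\infty]$, where a term is $0$ if $y_{i,\ell}=0$ and $+\infty$ if $y_{i,\ell}>0=\mu_i(\ell)$. Subscripts denote partial derivatives in $y$: $F_{i,\ell}=\partial F/\partial y_{i,\ell}$, $F_{i,\ell;j,\ell'}=\partial^2F/\partial y_{i,\ell}\partial y_{j,\ell'}$, likewise for $R$. Put $$b_{i,\ell}:=\sup_{\mathcal C}|F_{i,\ell}|,\quad c_{i,\ell;j,\ell'}:=\sup_{\mathcal C}|F_{i,\ell;j,\ell'}|,\quad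 e_{i,\ell;j,\ell'}:=\sup_{\theta\in\mathrm{supp}(\nu),\,y\in\mathcal C}|R_{i,\ell;j,\ell'}(\theta,y)|\in[0,\infty].$$ For $y\in\mathcal C$ and $M\ge1$ let $N^{\mathrm I}(y)$ be the set of $y'\in\mathcal C$ that agree with $y$ outside at most two rows $i_0,i_0'$, and $N^{\mathrm{II}}(y,M)$ the set of $y'\in\mathcal C$ such that for some row $i_0$, $M^{-1}y_{i,\ell}\le y'_{i,\ell}\le My_{i,\ell}$ for all $i\ne i_0$ and all $\ell$; put $H^{\mathrm I}_{i,\ell;j,\ell'}(y):=\sup_{N^{\mathrm I}(y)}|F_{i,\ell;j,\ell'}|$ and $H^{\mathrm{II}}_{i,\ell;j,\ell'}(y,M):=\sup_{N^{\mathrm{II}}(y,M)}|F_{i,\ell;j,\ell'}|$. Let $$M_j:=\exp\Big(2\max_{i\in[n],\,\ell\in[K_i],\,\ell'\in[K_j]}c_{i,\ell;j,\ell'}\Big),\qquad \Phi_{i,j}(y):=\exp\Big(2\sum_{\ell'=1}^{K_j}\max_{\ell\in[K_i]}H^{\mathrm I}_{i,\ell;j,\ell'}(y)\,y_{j,\ell'}\Big)-1,$$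 $$E_1:=\sup_{y\in\hat{\mathcal Y}}\Big\{\sum_{i}\max_{j}\Phi_{j,i}(y)\Big\}\cdot\sup_{y\in\hat{\mathcal Y},\,i\in[n],\,\ell\in[K_i]}\Big\{\sum_{j,\ell'}H^{\mathrm{II}}_{i,\ell;j,\ell'}(y,M_i)\,y_{j,\ell'}\Big\}+\sup_{y\in\hat{\mathcal Y}}\Big\{\sum_i\max_{\ell\in[K_i]}\sum_{\ell'=1}^{K_i}H^{\mathrm{II}}_{i,\ell;i,\ell'}(y,M_i)\,y_{i,\ell'}\Big\},$$ $$\Lambda(t):=\log\Big(2+\frac{\sum_i\max_{\ell}b_{i,\ell}}{t}\Big)\qquad(t>0).$$ For $\epsilon>0$ let $\mathcal D(\epsilon)\subseteq\prod_i\mathbb R^{K_i}$ be any finite set such that for every $y\in\hat{\mathcal Y}$ some $\delta\in\mathcal D(\epsilon)$ satisfies $\sum_i\max_{\ell}|F(U^{(1)}(y;i,\ell))-F(U(y;i))-\delta_{i,\ell}|\le\epsilon$, where $U^{(1)}(y;i,\ell)$ (resp. $U(y;i)$) is $y$ with row $i$ replaced by the $\ell$-th canonical vector (resp. by zero); put $E_2(\epsilon):=2\epsilon+\log|\mathcal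 D(\epsilon)|$. **Theorem.** There is an absolute constant $C>0$ such that, under Assumptions 1–3, for all $\epsilon,t>0$ with $t\ge E_1$, $$\frac1n\mathrm D_{\mathrm{KL}}\big(\hat P\,\big\|\,\mathbb P(\theta,Z\mid X)\big)\le\frac{\log S-\sup_{y\in\hat{\mathcal Y}}\{F(y)-I(y)\}}{n}+\frac{2\sum_{i=1}^n\max_{\ell,\ell'\in[K_i]}e_{i,\ell;i,\ell'}}{n}\le\frac{C(t+\Lambda(t))+E_2(\epsilon)+2\sum_{i=1}^n\max_{\ell,\ell'\in[K_i]}e_{i,\ell;i,\ell'}}{n}.$$ -/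

import Mathlib

open MeasureTheory InformationTheory
open scoped ENNReal

noncomputable section

namespace MeanFieldVI

/-! ### Latent variables -/

/-- Values of the global latent variables `θ = (θ_1, …, θ_m)`, with `θ_j ∈ ℝ^{d_j}`. -/
abbrev Glob {m : ℕ} (d : Fin m → ℕ) : Type := ∀ j : Fin m, EuclideanSpace ℝ (Fin (d j))

/-- Values of the local latent variables `z = (z_1, …, z_n)`, with `z_i ∈ [K_i]`. -/
abbrev Loc {n : ℕ} (K : Fin n → ℕ) : Type := ∀ i : Fin n, Fin (K i)

/-- Arrays `y = (y_{i,ℓ})` of real numbers, `i ∈ [n]`, `ℓ ∈ [K_i]`. -/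
abbrev Arr {n : ℕ} (K : Fin n → ℕ) : Type := ∀ i : Fin n, Fin (K i) → ℝ

/-! ### The Bayesian model, its posterior, and mean-field variational inference -/

/-- A Bayesian latent variable model together with the (fixed) observed data: a product base
measure on the space of latent variables, the prior density with respect to it, and the
likelihood of the observed data as a function of the latent variables. The evidence (marginal
density of the observed data) is positive and finite, so that Bayes' formula makes sense. -/
structure BayesModel {m n : ℕ} (d : Fin m → ℕ) (K : Fin n → ℕ) where
  /-- base measures of the global variables -/
  baseG : ∀ j : Fin m, Measure (EuclideanSpace ℝ (Fin (d j)))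
  /-- base measures of the local variables -/
  baseL : ∀ i : Fin n, Measure (Fin (K i))
  sigmaFiniteG : ∀ j, SigmaFinite (baseG j)
  sigmaFiniteL : ∀ i, SigmaFinite (baseL i)
  /-- prior density -/
  prior : Glob d × Loc K → ℝ≥0∞
  measurable_prior : Measurable prior
  lintegral_prior : ∫⁻ x, prior x ∂((Measure.pi baseG).prod (Measure.pi baseL)) = 1
  /-- likelihood of the observed data given the latent variables -/
  lik : Glob d × Loc K → ℝ≥0∞
  measurable_lik : Measurable lik
  evidence_ne_zero :
    ∫⁻ x, prior x * lik x ∂((Measure.pi baseG).prod (Measure.pi baseL)) ≠ 0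
  evidence_ne_top :
    ∫⁻ x, prior x * lik x ∂((Measure.pi baseG).prod (Measure.pi baseL)) ≠ ∞

namespace BayesModel

variable {m n : ℕ} {d : Fin m → ℕ} {K : Fin n → ℕ} (B : BayesModel d K)

/-- The product base measure on the space of all latent variables. -/
def base : Measure (Glob d × Loc K) := (Measure.pi B.baseG).prod (Measure.pi B.baseL)

/-- The evidence `p(X) = ∫ p(θ, z) L(X | θ, z)`. -/
def evidence : ℝ≥0∞ := ∫⁻ x, B.prior x * B.lik x ∂B.base

/-- The posterior distribution of `(θ, Z)` given the observed data, by Bayes' formula. -/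
def posterior : Measure (Glob d × Loc K) :=
  B.base.withDensity fun x => B.prior x * B.lik x / B.evidence

/-- The mean-field family: product distributions whose factors have densities `ξ_j`, `ζ_i`
with respect to the factors of the base measure. -/
def meanField : Set (Measure (Glob d × Loc K)) :=
  {P | ∃ (ξ : ∀ j : Fin m, EuclideanSpace ℝ (Fin (d j)) → ℝ≥0∞)
      (ζ : ∀ i : Fin n, Fin (K i) → ℝ≥0∞),
      (∀ j, Measurable (ξ j) ∧ ∫⁻ x, ξ j x ∂(B.baseG j) = 1) ∧
      (∀ i, Measurable (ζ i) ∧ ∫⁻ l, ζ i l ∂(B.baseL i) = 1) ∧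
      P = (Measure.pi fun j => (B.baseG j).withDensity (ξ j)).prod
            (Measure.pi fun i => (B.baseL i).withDensity (ζ i))}

/-- `P` is a variational posterior: it minimizes the Kullback-Leibler divergence to the
posterior over the mean-field family. -/
def IsVariationalPosterior (P : Measure (Glob d × Loc K)) : Prop :=
  P ∈ B.meanField ∧ ∀ P' ∈ B.meanField, klDiv P B.posterior ≤ klDiv P' B.posterior

end BayesModel

/-! ### Arrays, one-hot encodings and their relaxation -/

section Arrays

variable {n : ℕ} {K : Fin n → ℕ}

/-- The one-hot encoding `G(z)`. -/
def oneHot (z : Loc K) : Arr K := fun i l => if z i = l then 1 else 0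

variable (K) in
/-- The closed cube `∏ [0,1]^{K_i}`. -/
def cube : Set (Arr K) := {y | ∀ i l, 0 ≤ y i l ∧ y i l ≤ 1}

variable (K) in
/-- The continuous relaxation of the set of one-hot encodings. -/
def relaxed : Set (Arr K) := {y | y ∈ cube K ∧ ∀ i, ∑ l, y i l = 1}

/-- Replace row `i` of `y` by the `l`-th canonical vector. -/
def setRow (y : Arr K) (i : Fin n) (l : Fin (K i)) : Arr K :=
  Function.update y i (Pi.single l 1)

/-- Replace row `i` of `y` by zero. -/
def zeroRow (y : Arr K) (i : Fin n) : Arr K := Function.update y i 0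

/-- The partial derivative `∂F/∂y_{i,l}` on the closed cube. Derivatives are taken within the
cube, so for `F` of class `C²` on the closed cube (`ContDiffOn ℝ 2 F (cube K)`) this is the usual
partial derivative at interior points and its continuous extension at boundary points; the cube
being convex with nonempty interior, `ContDiffOn` on it says exactly that `F` is `C²` inside and
that `F` and its derivatives of order at most two extend continuously to the boundary. -/
def pderiv (F : Arr K → ℝ) (i : Fin n) (l : Fin (K i)) (y : Arr K) : ℝ :=
  fderivWithin ℝ F (cube K) y (Pi.single i (Pi.single l 1))

/-- The second partial derivative `∂²F/∂y_{i,l}∂y_{j,l'}` on the closed cube. -/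
def pderiv2 (F : Arr K → ℝ) (i : Fin n) (l : Fin (K i)) (j : Fin n) (l' : Fin (K j)) :
    Arr K → ℝ :=
  pderiv (pderiv F i l) j l'

end Arrays

/-! ### Hamiltonians and the three assumptions -/

section Hamiltonians

variable {m n : ℕ} {d : Fin m → ℕ} {K : Fin n → ℕ}

/-- A function of the form `g_0(a) + ∑_j g_j(θ_j, a)`. -/
def splitSum {α : Type} (g₀ : α → ℝ) (g : ∀ j : Fin m, EuclideanSpace ℝ (Fin (d j)) → α → ℝ)
    (θ : Glob d) (a : α) : ℝ :=
  g₀ a + ∑ j, g j (θ j) a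

/-- The posterior has a density proportional to `exp(r)` with respect to the product probability
measure `ν_1 ⊗ ⋯ ⊗ ν_m ⊗ μ_1 ⊗ ⋯ ⊗ μ_n`, where `r(θ, z) = r_0(z) + ∑_j r_j(θ_j, z)`. -/
structure FactorizedPosterior (Post : Measure (Glob d × Loc K))
    (ν : ∀ j : Fin m, Measure (EuclideanSpace ℝ (Fin (d j)))) (μ : ∀ i : Fin n, Measure (Fin (K i)))
    (r₀ : Loc K → ℝ) (r : ∀ j : Fin m, EuclideanSpace ℝ (Fin (d j)) → Loc K → ℝ) : Prop where
  measurable : ∀ j z, Measurable fun x => r j x z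
  density : ∃ c : ℝ≥0∞, Post = c • ((Measure.pi ν).prod (Measure.pi μ)).withDensity
    fun x => ENNReal.ofReal (Real.exp (splitSum r₀ r x.1 x.2))

/-- `R(θ, y) = R_0(y) + ∑_j R_j(θ_j, y)` is, for every `θ`, of class `C²` in `y` on the closed cube,
and extends `r(θ, z)` along the one-hot encoding; each `R_j(·, y)` is measurable, so that
integrals over `θ` make sense. -/
structure HamiltonianExtension
    (r₀ : Loc K → ℝ) (r : ∀ j : Fin m, EuclideanSpace ℝ (Fin (d j)) → Loc K → ℝ)
    (R₀ : Arr K → ℝ) (R : ∀ j : Fin m, EuclideanSpace ℝ (Fin (d j)) → Arr K → ℝ) : Prop where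
  measurable : ∀ j, ∀ y ∈ relaxed K, Measurable fun x => R j x y
  contDiffOn : ∀ θ : Glob d, ContDiffOn ℝ 2 (splitSum R₀ R θ) (cube K)
  extend : ∀ (θ : Glob d) (z : Loc K), splitSum R₀ R θ (oneHot z) = splitSum r₀ r θ z

/-- `F` is of class `C²` on the closed cube, and `F(y) = log ∫ exp(R(θ, y)) dν(θ)` (a finite
integral) for every `y` in the relaxation. -/
structure CollapsedExtension (ν : ∀ j : Fin m, Measure (EuclideanSpace ℝ (Fin (d j))))
    (R₀ : Arr K → ℝ) (R : ∀ j : Fin m, EuclideanSpace ℝ (Fin (d j)) → Arr K → ℝ)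
    (F : Arr K → ℝ) : Prop where
  contDiffOn : ContDiffOn ℝ 2 F (cube K)
  integrable : ∀ y ∈ relaxed K,
    Integrable (fun θ : Glob d => Real.exp (splitSum R₀ R θ y)) (Measure.pi ν)
  eq_log : ∀ y ∈ relaxed K,
    F y = Real.log (∫ θ : Glob d, Real.exp (splitSum R₀ R θ y) ∂(Measure.pi ν))

/-- The Hamiltonian of the collapsed posterior, `f(z) = log ∫ exp(r(θ, z)) dν(θ)`. -/
def collapsedHam (ν : ∀ j : Fin m, Measure (EuclideanSpace ℝ (Fin (d j))))
    (r₀ : Loc K → ℝ) (r : ∀ j : Fin m, EuclideanSpace ℝ (Fin (d j)) → Loc K → ℝ)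
    (z : Loc K) : ℝ :=
  Real.log (∫ θ : Glob d, Real.exp (splitSum r₀ r θ z) ∂(Measure.pi ν))

/-- The partition function `S = ∑_z exp(f(z)) μ(z)` of the collapsed posterior. -/
def partitionFn (ν : ∀ j : Fin m, Measure (EuclideanSpace ℝ (Fin (d j))))
    (μ : ∀ i : Fin n, Measure (Fin (K i)))
    (r₀ : Loc K → ℝ) (r : ∀ j : Fin m, EuclideanSpace ℝ (Fin (d j)) → Loc K → ℝ) : ℝ :=
  ∑ z : Loc K, Real.exp (collapsedHam ν r₀ r z) * (Measure.pi μ).real {z}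

/-- `I(y) = ∑_i ∑_l y_{i,l} log(y_{i,l} / μ_i(l))`, with value `0` for a term with `y_{i,l} = 0` and
`+∞` for a term with `y_{i,l} > 0 = μ_i(l)`. -/
def relEntropy (μ : ∀ i : Fin n, Measure (Fin (K i))) (y : Arr K) : EReal :=
  ∑ i, ∑ l, if y i l = 0 then (0 : EReal) else if μ i {l} = 0 then (⊤ : EReal)
    else ((y i l * Real.log (y i l / (μ i).real {l}) : ℝ) : EReal)

/-- `sup_{y} {F(y) - I(y)}` over the relaxation. -/
def supFI (μ : ∀ i : Fin n, Measure (Fin (K i))) (F : Arr K → ℝ) : EReal :=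
  ⨆ y ∈ relaxed K, ((F y : EReal) - relEntropy μ y)

/-- `e_{i,l;j,l'}`: the supremum of `|∂²R/∂y_{i,l}∂y_{j,l'}|` over `θ` in the support of `ν` and
`y` in the cube; it may be infinite. -/
def hessR (ν : ∀ j : Fin m, Measure (EuclideanSpace ℝ (Fin (d j))))
    (R₀ : Arr K → ℝ) (R : ∀ j : Fin m, EuclideanSpace ℝ (Fin (d j)) → Arr K → ℝ)
    (i : Fin n) (l : Fin (K i)) (j : Fin n) (l' : Fin (K j)) : ℝ≥0∞ :=
  ⨆ θ ∈ (Measure.pi ν).support, ⨆ y ∈ cube K,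
    ENNReal.ofReal |pderiv2 (splitSum R₀ R θ) i l j l' y|

/-- `2 ∑_i max_{l,l'} e_{i,l;i,l'}`. -/
def hessRTerm (ν : ∀ j : Fin m, Measure (EuclideanSpace ℝ (Fin (d j))))
    (R₀ : Arr K → ℝ) (R : ∀ j : Fin m, EuclideanSpace ℝ (Fin (d j)) → Arr K → ℝ) : ℝ≥0∞ :=
  2 * ∑ i, ⨆ (l : Fin (K i)) (l' : Fin (K i)), hessR ν R₀ R i l i l'

end Hamiltonians

/-! ### Gradient and Hessian bounds of `F`, smoothness term, complexity term

For `F` of class `C²` on the (compact) closed cube all the suprema below are suprema of bounded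
sets of real numbers, and they are over nonempty sets as soon as `n` and all `K_i` are positive. -/

section ErrorTerms

variable {n : ℕ} {K : Fin n → ℕ} (F : Arr K → ℝ)

/-- `b_{i,l}`. -/
def gradBd (i : Fin n) (l : Fin (K i)) : ℝ := sSup ((fun y => |pderiv F i l y|) '' cube K)

/-- `c_{i,l;j,l'}`. -/
def hessBd (i : Fin n) (l : Fin (K i)) (j : Fin n) (l' : Fin (K j)) : ℝ :=
  sSup ((fun y => |pderiv2 F i l j l' y|) '' cube K)

/-- Points of the cube that differ from `y` in at most two rows. -/
def nbhdI (y : Arr K) : Set (Arr K) :=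
  {y' | y' ∈ cube K ∧ ∃ i₀ i₁ : Fin n, ∀ i, i ≠ i₀ → i ≠ i₁ → y' i = y i}

/-- Local Hessian bound I. -/
def hessI (i : Fin n) (l : Fin (K i)) (j : Fin n) (l' : Fin (K j)) (y : Arr K) : ℝ :=
  sSup ((fun y' => |pderiv2 F i l j l' y'|) '' nbhdI y)

/-- Points of the cube all of whose entries, except for those of one row, are within a factor `M`
of the corresponding entries of `y`. -/
def nbhdII (y : Arr K) (M : ℝ) : Set (Arr K) :=
  {y' | y' ∈ cube K ∧ ∃ i₀ : Fin n, ∀ i, i ≠ i₀ → ∀ l, M⁻¹ * y i l ≤ y' i l ∧ y' i l ≤ M * y i l}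

/-- Local Hessian bound II. -/
def hessII (i : Fin n) (l : Fin (K i)) (j : Fin n) (l' : Fin (K j)) (y : Arr K) (M : ℝ) : ℝ :=
  sSup ((fun y' => |pderiv2 F i l j l' y'|) '' nbhdII y M)

/-- `M_j = exp(2 max_{i,l,l'} c_{i,l;j,l'})`. -/
def ratioBd (j : Fin n) : ℝ :=
  Real.exp (2 * ⨆ i : Fin n, ⨆ l : Fin (K i), ⨆ l' : Fin (K j), hessBd F i l j l')

/-- `Φ_{i,j}(y) = exp(2 ∑_{l'} max_l H^{(I)}_{i,l;j,l'}(y) y_{j,l'}) - 1`. -/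
def Phi (i j : Fin n) (y : Arr K) : ℝ :=
  Real.exp (2 * ∑ l' : Fin (K j), (⨆ l : Fin (K i), hessI F i l j l' y) * y j l') - 1

/-- The smoothness term `E_1`. -/
def smoothTerm : ℝ :=
  (⨆ y : relaxed K, ∑ i, ⨆ j, Phi F j i y.1) *
      (⨆ p : relaxed K × (Σ i : Fin n, Fin (K i)),
        ∑ j, ∑ l', hessII F p.2.1 p.2.2 j l' p.1.1 (ratioBd F p.2.1) * p.1.1 j l') +
    ⨆ y : relaxed K, ∑ i, ⨆ l : Fin (K i),
      ∑ l' : Fin (K i), hessII F i l i l' y.1 (ratioBd F i) * y.1 i l'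

/-- `Λ(t) = log(2 + (∑_i max_l b_{i,l}) / t)`. -/
def logTerm (t : ℝ) : ℝ := Real.log (2 + (∑ i, ⨆ l : Fin (K i), gradBd F i l) / t)

/-- The finite set `D` is admissible in the definition of the complexity term at level `ε`. -/
def IsGradientNet (ε : ℝ) (D : Finset (Arr K)) : Prop :=
  ∀ y ∈ relaxed K, ∃ δ ∈ D,
    ∑ i, ⨆ l : Fin (K i), |F (setRow y i l) - F (zeroRow y i) - δ i l| ≤ ε

/-- The complexity term `E_2(ε) = 2 ε + log |D(ε)|`. -/
def complexityTerm (ε : ℝ) (D : Finset (Arr K)) : ℝ := 2 * ε + Real.log (D.card : ℝ)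

end ErrorTerms

end MeanFieldVI

end

open MeanFieldVI

/-! The first inequality comes from testing minimality of the variational posterior against an
explicit competitor. For `y` in the relaxation whose rows are dominated by `μ`, let the local
variables be independent with marginals `y_i`, and give `θ_j` a `ν_j`-density proportional to `exp
R_j(·, y)`. Since `R` splits over `j`, this law lies in the mean-field family. Given `θ`, its mean
log-likelihood ratio against the posterior is `log S - F(y) + I(y)` plus the gap between `R(θ, y)`
and the mean of `R(θ, G(z))`. Switching the rows of `y` to one-hot rows one at a time makes every
first-order Taylor term vanish on average, so the gap costs only the diagonal Hessian
(`le_sum_prod_mul_oneHot`, `klDiv_variationalPosterior_le`). Taking the supremum over `y` finishes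
this half (`klDiv_le_log_sub_supFI`).

The second inequality amounts to `log S ≤ sup (F - I) + 2 E_1 + E_2`, a nonlinear large deviation
bound. Sample `z` from the Gibbs measure with weights `e^{F(G(z))} μ(z)`, and let `fitted` collect
the conditional laws of each row given the other rows. Two facts hold on Gibbs average.

(a) `F(G(z))` exceeds `F` at the fitted array by at most `2 E_1`
(`sum_gibbsWeight_mul_sub_fitted_le`). Along the segment between the two arrays, the derivative
pairs `G(z) - fitted` with the gradient of `F`. If the gradient is evaluated with row `i` erased,
its `i`-th contribution has conditional mean zero; the price of erasing is controlled by the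
Hessian.

(b) Comparing the Gibbs measure with a mixture of the product measures indexed by the gradient net
costs `log |D|` (`log_sum_gibbsWeight_le`). The log-likelihood under the nearest product measure is,
up to `2 ε`, that of the fitted conditional laws, whose average equals that of their relative
entropy.

Hence `log S` is bounded by a Gibbs average of `F - I` at fitted arrays plus errors, and some `z`
does at least as well as the average (`exists_log_sum_gibbsWeight_le`). -/

namespace MeanFieldVI

/-! ### Differential calculus on the closed cube. -/

section Calculus

variable {n : ℕ} {K : Fin n → ℕ}

theorem cube_eq_pi :
    cube K = Set.univ.pi fun i => Set.univ.pi fun _ : Fin (K i) => Set.Icc (0 : ℝ) 1 := by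
  ext y; simp only [cube, Set.mem_ofPred_eq, Set.mem_pi, Set.mem_univ, true_implies, Set.mem_Icc]

theorem convex_cube : Convex ℝ (cube K) := by
  rw [cube_eq_pi]
  exact convex_pi fun i _ => convex_pi fun l _ => convex_Icc 0 1

theorem isCompact_cube : IsCompact (cube K) := by
  rw [cube_eq_pi]
  exact isCompact_univ_pi fun i => isCompact_univ_pi fun l => isCompact_Icc

theorem uniqueDiffOn_cube : UniqueDiffOn ℝ (cube K) := by
  rw [cube_eq_pi]
  exact UniqueDiffOn.univ_pi fun i => UniqueDiffOn.univ_pi fun l =>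
    uniqueDiffOn_Icc zero_lt_one

theorem contDiffOn_pderiv {F : Arr K → ℝ} (hF : ContDiffOn ℝ 2 F (cube K)) (i : Fin n)
    (l : Fin (K i)) : ContDiffOn ℝ 1 (pderiv F i l) (cube K) :=
  (hF.fderivWithin uniqueDiffOn_cube (by norm_num)).clm_apply contDiffOn_const

theorem continuousOn_pderiv2 {F : Arr K → ℝ} (hF : ContDiffOn ℝ 2 F (cube K)) (i : Fin n)
    (l : Fin (K i)) (j : Fin n) (l' : Fin (K j)) : ContinuousOn (pderiv2 F i l j l') (cube K) :=
  ((contDiffOn_pderiv hF i l).continuousOn_fderivWithin uniqueDiffOn_cube le_rfl).clm_apply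
    continuousOn_const

theorem arr_eq_sum_single (w : Arr K) :
    w = ∑ i, ∑ l, w i l • (Pi.single i (Pi.single l (1 : ℝ)) : Arr K) := by
  ext j l'
  simp only [Finset.sum_apply, Pi.smul_apply, smul_eq_mul]
  rw [Finset.sum_eq_single j (by intro i _ hi; simp [hi.symm]) (by simp)]
  simp [Pi.single_apply]

theorem fderivWithin_eq_sum_pderiv (G : Arr K → ℝ) (x w : Arr K) :
    fderivWithin ℝ G (cube K) x w = ∑ i, ∑ l, w i l * pderiv G i l x := by
  conv_lhs => rw [arr_eq_sum_single w]
  simp [pderiv, map_sum]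

theorem hasDerivWithinAt_line {G : Arr K → ℝ} (hG : DifferentiableOn ℝ G (cube K)) {a w : Arr K}
    (ha : ∀ s ∈ Set.Icc (0 : ℝ) 1, a + s • w ∈ cube K) {s : ℝ} (hs : s ∈ Set.Icc (0 : ℝ) 1) :
    HasDerivWithinAt (fun s : ℝ => G (a + s • w))
      (∑ i, ∑ l, w i l * pderiv G i l (a + s • w)) (Set.Icc 0 1) s := by
  rw [← fderivWithin_eq_sum_pderiv]
  have h1 : HasDerivWithinAt (fun s : ℝ => a + s • w) w (Set.Icc 0 1) s := by
    simpa using ((hasDerivWithinAt_id s (Set.Icc (0 : ℝ) 1)).smul_const w).const_add a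
  exact (hG _ (ha s hs)).hasFDerivWithinAt.comp_hasDerivWithinAt s h1 ha

theorem line_mem_cube {x x' : Arr K} (hx : x ∈ cube K) (hx' : x' ∈ cube K) {s : ℝ}
    (hs : s ∈ Set.Icc (0 : ℝ) 1) : x + s • (x' - x) ∈ cube K :=
  convex_cube.add_smul_sub_mem hx hx' hs

/-- Mean value inequality for functions on the cube, in terms of partial derivatives. -/
theorem abs_sub_le_sum_pderiv {G : Arr K → ℝ} (hG : DifferentiableOn ℝ G (cube K)) {x x' : Arr K}
    (hx : x ∈ cube K) (hx' : x' ∈ cube K) (b : Arr K)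
    (hb : ∀ s ∈ Set.Icc (0 : ℝ) 1, ∀ i l, x' i l ≠ x i l →
      |pderiv G i l (x + s • (x' - x))| ≤ b i l) :
    |G x' - G x| ≤ ∑ i, ∑ l, b i l * |x' i l - x i l| := by
  have := norm_image_sub_le_of_norm_deriv_le_segment_01' (f := fun s : ℝ => G (x + s • (x' - x)))
    (C := ∑ i, ∑ l, b i l * |x' i l - x i l|)
    (fun s hs => hasDerivWithinAt_line hG (fun s hs => line_mem_cube hx hx' hs) hs) (by
      intro s hs
      refine (norm_sum_le _ _).trans (Finset.sum_le_sum fun i _ => (norm_sum_le _ _).trans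
        (Finset.sum_le_sum fun l _ => ?_))
      rw [Real.norm_eq_abs, abs_mul, mul_comm]
      by_cases h : x' i l = x i l
      · simp [h]
      · exact mul_le_mul_of_nonneg_right (hb s ⟨hs.1, hs.2.le⟩ i l h) (abs_nonneg _))
  simpa using this

theorem bddAbove_abs_pderiv2 {F : Arr K → ℝ} (hF : ContDiffOn ℝ 2 F (cube K)) (i : Fin n)
    (l : Fin (K i)) (j : Fin n) (l' : Fin (K j)) :
    BddAbove ((fun y => |pderiv2 F i l j l' y|) '' cube K) :=
  isCompact_cube.bddAbove_image (continuousOn_pderiv2 hF i l j l').abs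

theorem abs_pderiv2_le_hessBd {F : Arr K → ℝ} (hF : ContDiffOn ℝ 2 F (cube K)) (i : Fin n)
    (l : Fin (K i)) (j : Fin n) (l' : Fin (K j)) {y : Arr K} (hy : y ∈ cube K) :
    |pderiv2 F i l j l' y| ≤ hessBd F i l j l' :=
  le_csSup (bddAbove_abs_pderiv2 hF i l j l') ⟨y, hy, rfl⟩

variable (F : Arr K → ℝ) (i : Fin n) (l : Fin (K i)) (j : Fin n) (l' : Fin (K j))

theorem sSup_abs_nonneg (s : Set (Arr K)) (g : Arr K → ℝ) : 0 ≤ sSup ((fun y => |g y|) '' s) :=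
  Real.sSup_nonneg (by rintro _ ⟨y, _, rfl⟩; exact abs_nonneg _)

theorem hessBd_nonneg : 0 ≤ hessBd F i l j l' := sSup_abs_nonneg _ _

theorem hessI_nonneg (y : Arr K) : 0 ≤ hessI F i l j l' y := sSup_abs_nonneg _ _

theorem hessII_nonneg (y : Arr K) (M : ℝ) : 0 ≤ hessII F i l j l' y M := sSup_abs_nonneg _ _

variable {F}

theorem hessI_le_hessBd (hF : ContDiffOn ℝ 2 F (cube K)) (y : Arr K) :
    hessI F i l j l' y ≤ hessBd F i l j l' :=
  Real.sSup_le (by rintro _ ⟨y', hy', rfl⟩; exact abs_pderiv2_le_hessBd hF i l j l' hy'.1)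
    (hessBd_nonneg F i l j l')

theorem hessII_le_hessBd (hF : ContDiffOn ℝ 2 F (cube K)) (y : Arr K) (M : ℝ) :
    hessII F i l j l' y M ≤ hessBd F i l j l' :=
  Real.sSup_le (by rintro _ ⟨y', hy', rfl⟩; exact abs_pderiv2_le_hessBd hF i l j l' hy'.1)
    (hessBd_nonneg F i l j l')

theorem abs_pderiv2_le_hessI (hF : ContDiffOn ℝ 2 F (cube K)) {y y' : Arr K} (h : y' ∈ nbhdI y) :
    |pderiv2 F i l j l' y'| ≤ hessI F i l j l' y :=
  le_csSup ((bddAbove_abs_pderiv2 hF i l j l').mono (Set.image_mono fun _ h => h.1)) ⟨y', h, rfl⟩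

theorem abs_pderiv2_le_hessII (hF : ContDiffOn ℝ 2 F (cube K)) {y y' : Arr K} {M : ℝ}
    (h : y' ∈ nbhdII y M) : |pderiv2 F i l j l' y'| ≤ hessII F i l j l' y M :=
  le_csSup ((bddAbove_abs_pderiv2 hF i l j l').mono (Set.image_mono fun _ h => h.1)) ⟨y', h, rfl⟩

end Calculus

/-! ### One-hot encodings -/

section OneHot

variable {n : ℕ} {K : Fin n → ℕ}

theorem oneHot_mem_relaxed (z : Loc K) : oneHot z ∈ relaxed K := by
  refine ⟨fun i l => ?_, fun i => by simp [oneHot]⟩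
  unfold oneHot; split_ifs <;> norm_num

theorem setRow_mem_cube {x : Arr K} (hx : x ∈ cube K) (i : Fin n) (l : Fin (K i)) :
    setRow x i l ∈ cube K := by
  intro j l'
  rcases eq_or_ne j i with rfl | h
  · simp only [setRow, Function.update_self, Pi.single_apply]
    split_ifs <;> norm_num
  · simpa [setRow, h] using hx j l'

theorem zeroRow_mem_cube {x : Arr K} (hx : x ∈ cube K) (i : Fin n) : zeroRow x i ∈ cube K := by
  intro j l'
  rcases eq_or_ne j i with rfl | h
  · simp [zeroRow]
  · simpa [zeroRow, h] using hx j l'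

theorem setRow_oneHot (z : Loc K) (i : Fin n) (l : Fin (K i)) :
    setRow (oneHot z) i l = oneHot (Function.update z i l) := by
  ext j l'
  rcases eq_or_ne j i with rfl | h
  · simp [setRow, oneHot, Pi.single_apply, eq_comm]
  · simp [setRow, oneHot, h]

theorem setRow_update_oneHot (z : Loc K) (i : Fin n) (l l' : Fin (K i)) :
    setRow (oneHot (Function.update z i l)) i l' = setRow (oneHot z) i l' := by
  simp [setRow_oneHot]

theorem zeroRow_update_oneHot (z : Loc K) (i : Fin n) (l : Fin (K i)) :
    zeroRow (oneHot (Function.update z i l)) i = zeroRow (oneHot z) i := by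
  rw [← setRow_oneHot]; simp [zeroRow, setRow]

theorem setRow_eq_zeroRow_add (x : Arr K) (i : Fin n) (l : Fin (K i)) :
    setRow x i l = zeroRow x i + Pi.single i (Pi.single l (1 : ℝ)) := by
  ext j l'
  rcases eq_or_ne j i with rfl | h
  · simp [setRow, zeroRow]
  · simp [setRow, zeroRow, h]

end OneHot

end MeanFieldVI

namespace MeanFieldVI

/-! ### Gibbs weights on a finite set -/

section RowGibbs

variable {k : ℕ}

/-- The probability vector proportional to `w e^u`. -/
noncomputable def rowGibbs (w u : Fin k → ℝ) (l : Fin k) : ℝ :=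
  w l * Real.exp (u l) / ∑ l', w l' * Real.exp (u l')

/-- The log-Laplace functional `log ∑ w e^u`. -/
noncomputable def logLaplace (w u : Fin k → ℝ) : ℝ := Real.log (∑ l, w l * Real.exp (u l))

variable {w u v : Fin k → ℝ}

theorem sum_mul_exp_pos (hw : ∀ l, 0 ≤ w l) (hw1 : ∑ l, w l = 1) (u : Fin k → ℝ) :
    0 < ∑ l, w l * Real.exp (u l) := by
  obtain ⟨l, -, hl⟩ : ∃ l ∈ Finset.univ, w l ≠ 0 :=
    Finset.exists_ne_zero_of_sum_ne_zero (by rw [hw1]; norm_num)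
  exact Finset.sum_pos' (fun l _ => mul_nonneg (hw l) (Real.exp_pos _).le)
    ⟨l, Finset.mem_univ _, mul_pos ((hw l).lt_of_ne' hl) (Real.exp_pos _)⟩

theorem rowGibbs_nonneg (hw : ∀ l, 0 ≤ w l) (u : Fin k → ℝ) (l : Fin k) : 0 ≤ rowGibbs w u l :=
  div_nonneg (mul_nonneg (hw l) (Real.exp_pos _).le)
    (Finset.sum_nonneg fun l _ => mul_nonneg (hw l) (Real.exp_pos _).le)

theorem sum_rowGibbs (hw : ∀ l, 0 ≤ w l) (hw1 : ∑ l, w l = 1) (u : Fin k → ℝ) :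
    ∑ l, rowGibbs w u l = 1 := by
  simp only [rowGibbs]
  rw [← Finset.sum_div, div_self (sum_mul_exp_pos hw hw1 u).ne']

theorem rowGibbs_eq (hw : ∀ l, 0 ≤ w l) (hw1 : ∑ l, w l = 1) (u : Fin k → ℝ) (l : Fin k) :
    rowGibbs w u l = w l * Real.exp (u l - logLaplace w u) := by
  rw [rowGibbs, logLaplace, Real.exp_sub, Real.exp_log (sum_mul_exp_pos hw hw1 u), mul_div_assoc]

theorem logLaplace_le_add (hw : ∀ l, 0 ≤ w l) (hw1 : ∑ l, w l = 1) {a : ℝ}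
    (h : ∀ l, u l ≤ v l + a) : logLaplace w u ≤ logLaplace w v + a := by
  rw [logLaplace, logLaplace, ← Real.log_exp a,
    ← Real.log_mul (sum_mul_exp_pos hw hw1 v).ne' (Real.exp_pos _).ne']
  refine Real.log_le_log (sum_mul_exp_pos hw hw1 u) ?_
  rw [Finset.sum_mul]
  refine Finset.sum_le_sum fun l _ => ?_
  rw [mul_assoc, ← Real.exp_add]
  exact mul_le_mul_of_nonneg_left (Real.exp_le_exp.2 (h l)) (hw l)

/-- The weight and the normalizing constant each move by a factor of at most `e^a`, whence the
exponent `2a`. -/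
theorem rowGibbs_le_exp_mul (hw : ∀ l, 0 ≤ w l) (hw1 : ∑ l, w l = 1) {a : ℝ}
    (h : ∀ l, |u l - v l| ≤ a) (l : Fin k) :
    rowGibbs w u l ≤ Real.exp (2 * a) * rowGibbs w v l := by
  rw [rowGibbs_eq hw hw1, rowGibbs_eq hw hw1, mul_left_comm, ← Real.exp_add]
  refine mul_le_mul_of_nonneg_left (Real.exp_le_exp.2 ?_) (hw l)
  have h1 := (abs_le.1 (h l)).2
  have h2 := logLaplace_le_add (u := v) (v := u) hw hw1 (a := a)
    fun l => by linarith [(abs_le.1 (h l)).1]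
  linarith

theorem abs_rowGibbs_sub_le (hw : ∀ l, 0 ≤ w l) (hw1 : ∑ l, w l = 1) {a : ℝ}
    (h : ∀ l, |u l - v l| ≤ a) (l : Fin k) :
    |rowGibbs w u l - rowGibbs w v l| ≤ rowGibbs w v l * (Real.exp (2 * a) - 1) := by
  have h1 := rowGibbs_le_exp_mul hw hw1 h l
  have h2 := rowGibbs_le_exp_mul (u := v) (v := u) hw hw1 (fun l => by rw [abs_sub_comm]; exact h l) l
  have h3 := rowGibbs_nonneg hw v l
  have h4 := rowGibbs_nonneg hw u l
  have ha : 0 ≤ a := (abs_nonneg _).trans (h l)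
  have he : 1 ≤ Real.exp (2 * a) := Real.one_le_exp (by positivity)
  rw [abs_le]
  constructor
  · have : Real.exp (-(2 * a)) * rowGibbs w v l ≤ rowGibbs w u l := by
      rw [Real.exp_neg, inv_mul_le_iff₀ (Real.exp_pos _)]; exact h2
    -- This is `s + 1/s ≥ 2` for `s = e^{2a}`: the relative loss `1 - 1/s` never exceeds the
    -- relative gain `s - 1`.
    have h5 : 2 - Real.exp (2 * a) ≤ Real.exp (-(2 * a)) := by
      have := Real.add_one_le_exp (2 * a)
      rw [Real.exp_neg]
      have hp := Real.exp_pos (2 * a)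
      rw [← sub_nonneg]
      have : (Real.exp (2 * a))⁻¹ - (2 - Real.exp (2 * a))
          = (Real.exp (2 * a) - 1) ^ 2 * (Real.exp (2 * a))⁻¹ := by field_simp; ring
      rw [this]; positivity
    nlinarith [mul_le_mul_of_nonneg_right h5 h3]
  · nlinarith

end RowGibbs

/-! ### The fitted one-site conditional probabilities -/

section Fitted

variable {n : ℕ} {K : Fin n → ℕ}

/-- The increments of `F` when row `i` is switched from zero to the canonical vectors. -/
def rowIncr (F : Arr K → ℝ) (x : Arr K) (i : Fin n) (l : Fin (K i)) : ℝ :=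
  F (setRow x i l) - F (zeroRow x i)

/-- The conditional law of each coordinate given the others, under the Gibbs measure
`e^F` with reference weights `w`. -/
noncomputable def fitted (w : Arr K) (F : Arr K → ℝ) (x : Arr K) : Arr K :=
  fun i => rowGibbs (w i) (rowIncr F x i)

/-- Unnormalized Gibbs weights. -/
noncomputable def gibbsWeight (w : Arr K) (F : Arr K → ℝ) (z : Loc K) : ℝ :=
  Real.exp (F (oneHot z)) * ∏ i, w i (z i)

variable {w : Arr K} (hw : ∀ i l, 0 ≤ w i l) (hw1 : ∀ i, ∑ l, w i l = 1) {F : Arr K → ℝ}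

include hw in
theorem gibbsWeight_nonneg (z : Loc K) : 0 ≤ gibbsWeight w F z :=
  mul_nonneg (Real.exp_pos _).le (Finset.prod_nonneg fun i _ => hw i _)

include hw hw1 in
theorem fitted_mem_relaxed (F : Arr K → ℝ) (x : Arr K) : fitted w F x ∈ relaxed K := by
  refine ⟨fun i l => ⟨rowGibbs_nonneg (hw i) _ l, ?_⟩, fun i => sum_rowGibbs (hw i) (hw1 i) _⟩
  rw [← sum_rowGibbs (hw i) (hw1 i) (rowIncr F x i)]
  exact Finset.single_le_sum (f := fun l => rowGibbs (w i) (rowIncr F x i) l)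
    (fun l _ => rowGibbs_nonneg (hw i) _ l) (Finset.mem_univ l)

theorem rowIncr_update_oneHot (F : Arr K → ℝ) (z : Loc K) (i : Fin n) (l : Fin (K i)) :
    rowIncr F (oneHot (Function.update z i l)) i = rowIncr F (oneHot z) i := by
  ext l'; simp only [rowIncr, setRow_update_oneHot, zeroRow_update_oneHot]

theorem rowIncr_zeroRow (F : Arr K → ℝ) (x : Arr K) (i : Fin n) :
    rowIncr F (zeroRow x i) i = rowIncr F x i := by
  ext l'; simp [rowIncr, setRow, zeroRow]

/-- Isolates the dependence on the new value of coordinate `i`; the last factor shows why `rowGibbs`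
applied to `rowIncr` is the conditional law. -/
theorem gibbsWeight_update (z : Loc K) (i : Fin n) (l : Fin (K i)) :
    gibbsWeight w F (Function.update z i l) =
      Real.exp (F (zeroRow (oneHot z) i)) * (∏ j ∈ Finset.univ.erase i, w j (z j)) *
        (w i l * Real.exp (rowIncr F (oneHot z) i l)) := by
  rw [gibbsWeight, ← setRow_oneHot, ← Finset.mul_prod_erase _ _ (Finset.mem_univ i), rowIncr,
    Real.exp_sub, Function.update_self,
    Finset.prod_congr rfl fun j hj => by rw [Function.update_of_ne (Finset.ne_of_mem_erase hj)]]
  field_simp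

/-- Detailed balance for resampling coordinate `i` from its conditional law. -/
theorem gibbsWeight_mul_fitted (z : Loc K) (i : Fin n) (l : Fin (K i)) :
    gibbsWeight w F z * fitted w F (oneHot z) i l =
      gibbsWeight w F (Function.update z i l) * fitted w F (oneHot z) i (z i) := by
  conv_lhs => rw [← Function.update_eq_self i z, gibbsWeight_update, Function.update_eq_self i z]
  rw [gibbsWeight_update, fitted, rowGibbs, rowGibbs]
  ring

/-- Resampling a coordinate from its conditional law is an involution on pairs. -/
def resample (i : Fin n) : (Loc K × Fin (K i)) ≃ (Loc K × Fin (K i)) :=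
  Function.Involutive.toPerm (fun p => (Function.update p.1 i p.2, p.1 i)) (by
    rintro ⟨z, l⟩; simp)

include hw hw1 in
/-- Under the Gibbs measure, `fitted` is the conditional expectation of the one-hot encoding. -/
theorem sum_gibbsWeight_mul_oneHot_sub_fitted (i : Fin n) (h : Loc K → Fin (K i) → ℝ)
    (hh : ∀ z l, h (Function.update z i l) = h z) :
    ∑ z, gibbsWeight w F z * ∑ l, (oneHot z i l - fitted w F (oneHot z) i l) * h z l = 0 := by
  have h1 : ∑ z, ∑ l, gibbsWeight w F z * fitted w F (oneHot z) i l * h z l =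
      ∑ z, gibbsWeight w F z * h z (z i) := by
    -- Swapping the old and the new value of coordinate `i` preserves the joint weight by detailed
    -- balance, so the resampled value may be replaced by the original one.
    rw [← Fintype.sum_prod_type', ← (resample i).sum_comp, Fintype.sum_prod_type]
    refine Finset.sum_congr rfl fun z _ => ?_
    have : ∀ l, gibbsWeight w F (resample i (z, l)).1 *
        fitted w F (oneHot (resample i (z, l)).1) i (resample i (z, l)).2 *
          h (resample i (z, l)).1 (resample i (z, l)).2 =
        gibbsWeight w F z * h z (z i) * fitted w F (oneHot z) i l := by
      intro l
      have e : resample i (z, l) = (Function.update z i l, z i) := rfl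
      have e2 : fitted w F (oneHot (Function.update z i l)) i = fitted w F (oneHot z) i := by
        rw [fitted, fitted, rowIncr_update_oneHot]
      rw [e]
      simp only [hh, e2]
      rw [← gibbsWeight_mul_fitted]; ring
    simp only [this]
    rw [← Finset.mul_sum, (fitted_mem_relaxed hw hw1 F _).2 i, mul_one]
  have h2 : ∀ z, ∑ l, oneHot z i l * h z l = h z (z i) := fun z => by simp [oneHot]
  simp only [sub_mul, Finset.sum_sub_distrib, h2, mul_sub, Finset.mul_sum, ← mul_assoc]
  rw [h1, sub_self]

include hw hw1 in
theorem sum_gibbsWeight_pos (F : Arr K → ℝ) : 0 < ∑ z, gibbsWeight w F z := by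
  have : ∀ i, ∃ l, w i l ≠ 0 := fun i => by
    obtain ⟨l, -, hl⟩ := Finset.exists_ne_zero_of_sum_ne_zero
      (show ∑ l, w i l ≠ 0 by rw [hw1]; norm_num)
    exact ⟨l, hl⟩
  choose z hz using this
  exact Finset.sum_pos' (fun z _ => gibbsWeight_nonneg hw z) ⟨z, Finset.mem_univ _,
    mul_pos (Real.exp_pos _) (Finset.prod_pos fun i _ => (hw i _).lt_of_ne' (hz i))⟩

/-- Gibbs' inequality for the mixture of finitely many product measures: the log-partition
function is at most the mean of the log-likelihood ratio plus the log number of components. -/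
theorem log_sum_gibbsWeight_le (hw : ∀ i l, 0 ≤ w i l) (hw1 : ∀ i, ∑ l, w i l = 1)
    (D : Finset (Arr K)) (σ : Loc K → Arr K) (hσ : ∀ z, σ z ∈ D) :
    (∑ z, gibbsWeight w F z) * Real.log (∑ z, gibbsWeight w F z) ≤
      (∑ z, gibbsWeight w F z * (F (oneHot z) -
        ∑ i, (σ z i (z i) - logLaplace (w i) (σ z i)))) +
      (∑ z, gibbsWeight w F z) * Real.log D.card := by
  classical
  set S := ∑ z, gibbsWeight w F z with hS
  have hSpos : 0 < S := sum_gibbsWeight_pos hw hw1 F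
  have hne : D.card ≠ 0 := by
    obtain ⟨z, -, -⟩ := Finset.exists_ne_zero_of_sum_ne_zero hSpos.ne'
    exact Finset.card_ne_zero_of_mem (hσ z)
  have hD : (0 : ℝ) < D.card := by positivity
  let p : Arr K → Loc K → ℝ := fun δ z => ∏ i, rowGibbs (w i) (δ i) (z i)
  have hp0 : ∀ δ z, 0 ≤ p δ z := fun δ z => Finset.prod_nonneg fun i _ => rowGibbs_nonneg (hw i) _ _
  have hp1 : ∀ δ, ∑ z, p δ z = 1 := fun δ => by
    simp only [p]
    rw [← Fintype.prod_sum]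
    exact Finset.prod_eq_one fun i _ => sum_rowGibbs (hw i) (hw1 i) _
  -- The selected component varies with `z`, but it is dominated by the sum of all components, whose
  -- total mass is the number of components.
  have hsum : ∑ z, p (σ z) z ≤ D.card := by
    calc ∑ z, p (σ z) z ≤ ∑ z, ∑ δ ∈ D, p δ z := Finset.sum_le_sum fun z _ =>
          Finset.single_le_sum (f := fun δ => p δ z) (fun δ _ => hp0 δ z) (hσ z)
      _ = D.card := by rw [Finset.sum_comm]; simp [hp1]
  -- This is `x + 1 ≤ e^x` with `x` the logarithm of `S p(σ z)(z) / (|D| gibbsWeight)` (when the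
  -- weight is nonzero), multiplied by the weight: a pointwise form of Gibbs' inequality.
  have hz : ∀ z, gibbsWeight w F z * (Real.log S - F (oneHot z) +
      ∑ i, (σ z i (z i) - logLaplace (w i) (σ z i)) - Real.log D.card) ≤
      S * p (σ z) z / D.card - gibbsWeight w F z := by
    intro z
    set a := ∑ i, (σ z i (z i) - logLaplace (w i) (σ z i)) with ha
    have hpe : p (σ z) z = (∏ i, w i (z i)) * Real.exp a := by
      simp only [p, rowGibbs_eq (hw _) (hw1 _), Finset.prod_mul_distrib]
      rw [ha, Real.exp_sum]
    have h1 := Real.add_one_le_exp (Real.log S - F (oneHot z) + a - Real.log D.card)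
    have h2 : gibbsWeight w F z * Real.exp (Real.log S - F (oneHot z) + a - Real.log D.card) =
        S * p (σ z) z / D.card := by
      rw [hpe, gibbsWeight, Real.exp_sub, Real.exp_add, Real.exp_sub, Real.exp_log hSpos,
        Real.exp_log hD]
      field_simp
    have := mul_le_mul_of_nonneg_left h1 (gibbsWeight_nonneg hw z (F := F))
    rw [h2] at this
    linarith
  have := Finset.sum_le_sum fun z (_ : z ∈ Finset.univ) => hz z
  rw [Finset.sum_sub_distrib, ← hS, ← Finset.sum_div, ← Finset.mul_sum] at this
  have h3 : S * (∑ z, p (σ z) z) / D.card ≤ S := by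
    rw [div_le_iff₀ hD]; exact mul_le_mul_of_nonneg_left hsum hSpos.le
  have h4 : ∑ z, gibbsWeight w F z * (Real.log S - F (oneHot z) +
      ∑ i, (σ z i (z i) - logLaplace (w i) (σ z i)) - Real.log D.card) =
      S * Real.log S - S * Real.log D.card - ∑ z, gibbsWeight w F z * (F (oneHot z) -
        ∑ i, (σ z i (z i) - logLaplace (w i) (σ z i))) := by
    rw [hS, Finset.sum_mul, Finset.sum_mul, ← Finset.sum_sub_distrib, ← Finset.sum_sub_distrib]
    refine Finset.sum_congr rfl fun z _ => ?_
    ring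
  rw [h4] at this
  linarith

end Fitted

end MeanFieldVI

namespace MeanFieldVI

/-! ### The smoothness term and the nonlinear large deviation bound. -/

section Smoothness

variable {n : ℕ} {K : Fin n → ℕ} {F : Arr K → ℝ}

theorem le_iSup_finite {ι : Type*} [Finite ι] (f : ι → ℝ) (i : ι) : f i ≤ ⨆ i, f i :=
  le_ciSup (Set.finite_range f).bddAbove i

theorem iSup_mono_finite {ι : Type*} [Finite ι] {f g : ι → ℝ} (h : ∀ i, f i ≤ g i) :
    ⨆ i, f i ≤ ⨆ i, g i :=
  ciSup_mono (Set.finite_range g).bddAbove h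

theorem Phi_nonneg (j i : Fin n) {y : Arr K} (hy : y ∈ cube K) : 0 ≤ Phi F j i y := by
  refine sub_nonneg.2 (Real.one_le_exp (mul_nonneg zero_le_two (Finset.sum_nonneg fun l _ =>
    mul_nonneg (Real.iSup_nonneg fun l' => hessI_nonneg F j l' i l y) (hy i l).1)))

/-- A real supremum dominates its family only if the family is bounded. Here and in the next two
lemmas, entries of `y` are at most one and local Hessian bounds are at most the global ones, which
are finite by compactness. -/
theorem bddAbove_sum_Phi (hF : ContDiffOn ℝ 2 F (cube K)) :
    BddAbove (Set.range fun y : relaxed K => ∑ i, ⨆ j, Phi F j i y.1) := by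
  refine ⟨∑ i, ⨆ j, (Real.exp (2 * ∑ l', ⨆ l, hessBd F j l i l') - 1), ?_⟩
  rintro _ ⟨y, rfl⟩
  refine Finset.sum_le_sum fun i _ => iSup_mono_finite fun j => sub_le_sub_right
    (Real.exp_le_exp.2 (mul_le_mul_of_nonneg_left (Finset.sum_le_sum fun l' _ => ?_) zero_le_two)) _
  refine (mul_le_of_le_one_right (Real.iSup_nonneg fun l => hessI_nonneg F j l i l' _)
    (y.2.1 i l').2).trans (iSup_mono_finite fun l => hessI_le_hessBd j l i l' hF _)

theorem bddAbove_sum_hessII (hF : ContDiffOn ℝ 2 F (cube K)) :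
    BddAbove (Set.range fun p : relaxed K × (Σ i : Fin n, Fin (K i)) =>
      ∑ j, ∑ l', hessII F p.2.1 p.2.2 j l' p.1.1 (ratioBd F p.2.1) * p.1.1 j l') := by
  refine ⟨⨆ q : Σ i : Fin n, Fin (K i), ∑ j, ∑ l', hessBd F q.1 q.2 j l', ?_⟩
  rintro _ ⟨⟨y, q⟩, rfl⟩
  refine le_trans (Finset.sum_le_sum fun j _ => Finset.sum_le_sum fun l' _ => ?_)
    (le_iSup_finite (fun q : Σ i : Fin n, Fin (K i) => ∑ j, ∑ l', hessBd F q.1 q.2 j l') q)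
  exact (mul_le_of_le_one_right (hessII_nonneg _ _ _ _ _ _ _) (y.2.1 j l').2).trans
    (hessII_le_hessBd _ _ _ _ hF _ _)

theorem bddAbove_sum_hessII_diag (hF : ContDiffOn ℝ 2 F (cube K)) :
    BddAbove (Set.range fun y : relaxed K => ∑ i, ⨆ l : Fin (K i),
      ∑ l' : Fin (K i), hessII F i l i l' y.1 (ratioBd F i) * y.1 i l') := by
  refine ⟨∑ i, ⨆ l : Fin (K i), ∑ l' : Fin (K i), hessBd F i l i l', ?_⟩
  rintro _ ⟨y, rfl⟩
  refine Finset.sum_le_sum fun i _ => iSup_mono_finite fun l => Finset.sum_le_sum fun l' _ => ?_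
  exact (mul_le_of_le_one_right (hessII_nonneg _ _ _ _ _ _ _) (y.2.1 i l').2).trans
    (hessII_le_hessBd _ _ _ _ hF _ _)

/-- The suprema in `smoothTerm` are taken separately, so `Phi` and the Hessian bounds may be
evaluated at different arrays: below, at the one-hot array and at a point of the segment to the
fitted array. -/
theorem sum_le_smoothTerm (hF : ContDiffOn ℝ 2 F (cube K)) {x y : Arr K} (hx : x ∈ relaxed K)
    (hy : y ∈ relaxed K) {c : Fin n → ℝ}
    (hc : ∀ i, c i ≤ ⨆ l : Fin (K i), ((⨆ j, Phi F j i x) *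
        (∑ j, ∑ l', hessII F i l j l' y (ratioBd F i) * y j l') +
      ∑ l' : Fin (K i), hessII F i l i l' y (ratioBd F i) * y i l')) :
    ∑ i, c i ≤ smoothTerm F := by
  set A := ⨆ p : relaxed K × (Σ i : Fin n, Fin (K i)),
        ∑ j, ∑ l', hessII F p.2.1 p.2.2 j l' p.1.1 (ratioBd F p.2.1) * p.1.1 j l' with hA
  have hA0 : 0 ≤ A := Real.iSup_nonneg fun p => Finset.sum_nonneg fun j _ =>
    Finset.sum_nonneg fun l' _ => mul_nonneg (hessII_nonneg _ _ _ _ _ _ _) (p.1.2.1 j l').1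
  have hP0 : ∀ i, 0 ≤ ⨆ j, Phi F j i x := fun i => Real.iSup_nonneg fun j => Phi_nonneg j i hx.1
  have h1 : ∀ i, c i ≤ (⨆ j, Phi F j i x) * A +
      ⨆ l : Fin (K i), ∑ l' : Fin (K i), hessII F i l i l' y (ratioBd F i) * y i l' := by
    intro i
    refine (hc i).trans (Real.iSup_le (fun l => add_le_add (mul_le_mul_of_nonneg_left ?_ (hP0 i)) ?_)
      (add_nonneg (mul_nonneg (hP0 i) hA0) (Real.iSup_nonneg fun l => Finset.sum_nonneg
        fun l' _ => mul_nonneg (hessII_nonneg _ _ _ _ _ _ _) (hy.1 i l').1)))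
    · exact le_ciSup (bddAbove_sum_hessII hF) (⟨⟨y, hy⟩, ⟨i, l⟩⟩ : relaxed K × (Σ i, Fin (K i)))
    · exact le_iSup_finite
        (fun l => ∑ l' : Fin (K i), hessII F i l i l' y (ratioBd F i) * y i l') l
  refine (Finset.sum_le_sum fun i _ => h1 i).trans ?_
  rw [Finset.sum_add_distrib, ← Finset.sum_mul, smoothTerm]
  refine add_le_add (mul_le_mul_of_nonneg_right ?_ hA0) ?_
  · exact le_ciSup (bddAbove_sum_Phi hF) (⟨x, hx⟩ : relaxed K)
  · exact le_ciSup (bddAbove_sum_hessII_diag hF) (⟨y, hy⟩ : relaxed K)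

/-- Effect on the increments in row `j` of zeroing a different row `i` of a one-hot array. -/
theorem abs_rowIncr_sub_le (hF : ContDiffOn ℝ 2 F (cube K)) (z : Loc K) {i j : Fin n} (hij : j ≠ i)
    (l : Fin (K j)) :
    |rowIncr F (zeroRow (oneHot z) i) j l - rowIncr F (oneHot z) j l| ≤
      hessI F j l i (z i) (oneHot z) := by
  set x := oneHot z with hx
  have hxc : x ∈ cube K := (oneHot_mem_relaxed z).1
  set a := zeroRow x j with ha
  set b := zeroRow (zeroRow x i) j with hb
  have hac : a ∈ cube K := zeroRow_mem_cube hxc j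
  have hbc : b ∈ cube K := zeroRow_mem_cube (zeroRow_mem_cube hxc i) j
  set w : Arr K := Pi.single j (Pi.single l (1 : ℝ)) with hw
  have hG : DifferentiableOn ℝ F (cube K) := hF.differentiableOn (by norm_num)
  have haw : a + w ∈ cube K := by
    rw [ha, hw, ← setRow_eq_zeroRow_add]; exact setRow_mem_cube hxc j l
  have hbw : b + w ∈ cube K := by
    rw [hb, hw, ← setRow_eq_zeroRow_add]; exact setRow_mem_cube (zeroRow_mem_cube hxc i) j l
  have la : ∀ s ∈ Set.Icc (0 : ℝ) 1, a + s • w ∈ cube K := fun s hs => by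
    simpa using line_mem_cube hac haw hs
  have lb : ∀ s ∈ Set.Icc (0 : ℝ) 1, b + s • w ∈ cube K := fun s hs => by
    simpa using line_mem_cube hbc hbw hs
  have hsum : ∀ y : Arr K, ∑ i, ∑ l, w i l * pderiv F i l y = pderiv F j l y := fun y => by
    rw [← fderivWithin_eq_sum_pderiv, pderiv]
  have hdiff : ∀ s : ℝ, ∀ i' l', (b + s • w) i' l' - (a + s • w) i' l' =
      if i' = i then - x i' l' else 0 := by
    intro s i' l'
    rcases eq_or_ne i' j with rfl | h1
    · simp [ha, hb, zeroRow, hij]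
    · rcases eq_or_ne i' i with rfl | h2
      · simp [ha, hb, zeroRow, h1]
      · simp [ha, hb, zeroRow, h1, h2]
  -- A mixed second difference of `F` in rows `i` and `j`. Row `i` of a one-hot array has a single
  -- nonzero entry, so one Hessian entry suffices; all intermediate points agree with `x` outside
  -- these two rows, hence lie in `nbhdI x`.
  have key := norm_image_sub_le_of_norm_deriv_le_segment_01'
    (f := fun s : ℝ => F (b + s • w) - F (a + s • w)) (C := hessI F j l i (z i) x)
    (fun s hs => (hasDerivWithinAt_line hG lb hs).sub (hasDerivWithinAt_line hG la hs)) (by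
      intro s hs
      have hs' : s ∈ Set.Icc (0 : ℝ) 1 := ⟨hs.1, hs.2.le⟩
      rw [hsum, hsum, Real.norm_eq_abs]
      refine (abs_sub_le_sum_pderiv ((contDiffOn_pderiv hF j l).differentiableOn one_ne_zero)
        (la s hs') (lb s hs') (fun i' l' => hessI F j l i' l' x) ?_).trans ?_
      · intro u hu i' l' _
        refine abs_pderiv2_le_hessI j l i' l' hF ⟨line_mem_cube (la s hs') (lb s hs') hu, i, j, ?_⟩
        intro i'' h1 h2
        ext l''
        have e := hdiff s i'' l''
        rw [if_neg h1] at e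
        simp only [Pi.add_apply, Pi.smul_apply, Pi.sub_apply, smul_eq_mul] at e ⊢
        rw [e]
        simp [ha, zeroRow, h2, hw]
      · simp only [hdiff]
        rw [Finset.sum_eq_single i (by intro i' _ h; simp [h]) (by simp),
          Finset.sum_eq_single (z i) (by intro l' _ h; simp [hx, oneHot, h.symm]) (by simp)]
        simp [hx, oneHot])
  simp only [one_smul, zero_smul, add_zero, Real.norm_eq_abs] at key
  have e1 : rowIncr F (zeroRow x i) j l - rowIncr F x j l =
      F (b + w) - F (a + w) - (F b - F a) := by
    rw [rowIncr, rowIncr, setRow_eq_zeroRow_add, setRow_eq_zeroRow_add]; ring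
  rw [e1]; exact key

theorem Phi_oneHot (j i : Fin n) (z : Loc K) :
    Phi F j i (oneHot z) = Real.exp (2 * ⨆ l, hessI F j l i (z i) (oneHot z)) - 1 := by
  simp [Phi, oneHot]

theorem Phi_oneHot_add_one_le (hF : ContDiffOn ℝ 2 F (cube K)) (j i : Fin n) (z : Loc K) :
    Phi F j i (oneHot z) + 1 ≤ ratioBd F i := by
  rw [Phi_oneHot, sub_add_cancel, ratioBd]
  refine Real.exp_le_exp.2 (mul_le_mul_of_nonneg_left ?_ zero_le_two)
  refine le_trans (iSup_mono_finite fun l => ?_)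
    (le_iSup_finite (fun j => ⨆ l, ⨆ l', hessBd F j l i l') j)
  exact (hessI_le_hessBd j l i (z i) hF _).trans (le_iSup_finite (fun l' => hessBd F j l i l') (z i))

variable {w : Arr K} (hw : ∀ i l, 0 ≤ w i l) (hw1 : ∀ i, ∑ l, w i l = 1)

include hw hw1 in
theorem abs_fitted_zeroRow_sub_le (hF : ContDiffOn ℝ 2 F (cube K)) (z : Loc K) {i j : Fin n}
    (hij : j ≠ i) (l : Fin (K j)) :
    |fitted w F (zeroRow (oneHot z) i) j l - fitted w F (oneHot z) j l| ≤
      fitted w F (oneHot z) j l * Phi F j i (oneHot z) := by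
  rw [Phi_oneHot]
  exact abs_rowGibbs_sub_le (hw j) (hw1 j) (fun l => (abs_rowIncr_sub_le hF z hij l).trans
    (le_iSup_finite (fun l => hessI F j l i (z i) (oneHot z)) l)) l

include hw hw1 in
-- Two-sided multiplicative control of the other rows; this is what places the perturbed arrays in
-- `nbhdII` with factor `ratioBd F i`.
theorem fitted_zeroRow_le (hF : ContDiffOn ℝ 2 F (cube K)) (z : Loc K) {i j : Fin n}
    (hij : j ≠ i) (l : Fin (K j)) :
    fitted w F (zeroRow (oneHot z) i) j l ≤ ratioBd F i * fitted w F (oneHot z) j l ∧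
    (ratioBd F i)⁻¹ * fitted w F (oneHot z) j l ≤ fitted w F (zeroRow (oneHot z) i) j l := by
  have h : ∀ l, |rowIncr F (zeroRow (oneHot z) i) j l - rowIncr F (oneHot z) j l| ≤
      ⨆ l, hessI F j l i (z i) (oneHot z) := fun l => (abs_rowIncr_sub_le hF z hij l).trans
    (le_iSup_finite (fun l => hessI F j l i (z i) (oneHot z)) l)
  have hM := Phi_oneHot_add_one_le hF j i z
  rw [Phi_oneHot, sub_add_cancel] at hM
  constructor
  · exact (rowGibbs_le_exp_mul (hw j) (hw1 j) h l).trans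
      (mul_le_mul_of_nonneg_right hM (rowGibbs_nonneg (hw j) _ l))
  · rw [inv_mul_le_iff₀ (lt_of_lt_of_le (Real.exp_pos _) hM)]
    exact (rowGibbs_le_exp_mul (hw j) (hw1 j) (fun l => by rw [abs_sub_comm]; exact h l) l).trans
      (mul_le_mul_of_nonneg_right hM (rowGibbs_nonneg (hw j) _ l))

/-- The segment from the fitted array to the array itself. -/
noncomputable def interp (w : Arr K) (F : Arr K → ℝ) (s : ℝ) (x : Arr K) : Arr K :=
  fitted w F x + s • (x - fitted w F x)

theorem interp_apply (w : Arr K) (F : Arr K → ℝ) (s : ℝ) (x : Arr K) (i : Fin n) (l : Fin (K i)) :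
    interp w F s x i l = (1 - s) * fitted w F x i l + s * x i l := by
  simp only [interp, Pi.add_apply, Pi.smul_apply, Pi.sub_apply, smul_eq_mul]; ring

include hw hw1 in
theorem interp_mem_cube {x : Arr K} (hx : x ∈ cube K) {s : ℝ} (hs : s ∈ Set.Icc (0 : ℝ) 1) :
    interp w F s x ∈ cube K :=
  line_mem_cube (fitted_mem_relaxed hw hw1 F x).1 hx hs

include hw hw1 in
theorem interp_mem_relaxed {x : Arr K} (hx : x ∈ relaxed K) {s : ℝ} (hs : s ∈ Set.Icc (0 : ℝ) 1) :
    interp w F s x ∈ relaxed K := by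
  refine ⟨interp_mem_cube hw hw1 hx.1 hs, fun i => ?_⟩
  simp only [interp_apply, Finset.sum_add_distrib, ← Finset.mul_sum]
  rw [(fitted_mem_relaxed hw hw1 F x).2 i, hx.2 i]; ring

theorem one_le_ratioBd (F : Arr K → ℝ) (i : Fin n) : 1 ≤ ratioBd F i :=
  Real.one_le_exp (mul_nonneg zero_le_two (Real.iSup_nonneg fun _ => Real.iSup_nonneg fun _ =>
    Real.iSup_nonneg fun _ => hessBd_nonneg _ _ _ _ _))

include hw hw1 in
-- Erasing row `i` of the one-hot array acts on the segment point in two ways. Rows `j ≠ i` change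
-- only through their fitted part, by a relative amount of at most `Phi`. Row `i` keeps its fitted
-- part, which ignores row `i`, and loses its one-hot part; the final diagonal sum pays for this.
theorem abs_pderiv_interp_sub_le (hF : ContDiffOn ℝ 2 F (cube K)) (z : Loc K) (i : Fin n)
    (l : Fin (K i)) {s : ℝ} (hs : s ∈ Set.Icc (0 : ℝ) 1) :
    |pderiv F i l (interp w F s (zeroRow (oneHot z) i)) - pderiv F i l (interp w F s (oneHot z))| ≤
      (⨆ j, Phi F j i (oneHot z)) * (∑ j, ∑ l', hessII F i l j l' (interp w F s (oneHot z))
          (ratioBd F i) * interp w F s (oneHot z) j l') +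
        ∑ l' : Fin (K i), hessII F i l i l' (interp w F s (oneHot z)) (ratioBd F i) *
          interp w F s (oneHot z) i l' := by
  set x := oneHot z with hx
  set x₀ := zeroRow x i with hx₀
  have hxc : x ∈ cube K := (oneHot_mem_relaxed z).1
  have hyc := interp_mem_cube (F := F) hw hw1 hxc hs
  have hyc' := interp_mem_cube (F := F) hw hw1 (zeroRow_mem_cube hxc i) hs
  have hM := one_le_ratioBd F i
  have hM0 : 0 < ratioBd F i := by linarith
  have hs1 : 0 ≤ 1 - s := sub_nonneg.2 hs.2
  have hx₀j : ∀ j, j ≠ i → x₀ j = x j := fun j h => by simp [hx₀, zeroRow, h]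
  have hfi : fitted w F x₀ i = fitted w F x i := by rw [fitted, fitted, hx₀, rowIncr_zeroRow]
  have hP0 : 0 ≤ ⨆ j, Phi F j i x := Real.iSup_nonneg fun j => Phi_nonneg j i hxc
  refine (abs_sub_le_sum_pderiv ((contDiffOn_pderiv hF i l).differentiableOn one_ne_zero)
    hyc hyc' (fun j l' => hessII F i l j l' (interp w F s x) (ratioBd F i)) ?_).trans ?_
  · intro u hu j l' _
    refine abs_pderiv2_le_hessII i l j l' hF ⟨line_mem_cube hyc hyc' hu, i, fun k hk a => ?_⟩
    have hy0 := (hyc k a).1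
    obtain ⟨h1, h2⟩ := fitted_zeroRow_le hw hw1 hF z hk a
    rw [← hx, ← hx₀] at h1 h2
    have hxa := (hxc k a).1
    have hb1 : interp w F s x₀ k a ≤ ratioBd F i * interp w F s x k a := by
      rw [interp_apply, interp_apply, hx₀j k hk]
      nlinarith [mul_le_mul_of_nonneg_left h1 hs1,
        mul_nonneg (mul_nonneg hs.1 hxa) (sub_nonneg.2 hM)]
    have hb2 : (ratioBd F i)⁻¹ * interp w F s x k a ≤ interp w F s x₀ k a := by
      have hM' : (ratioBd F i)⁻¹ ≤ 1 := inv_le_one_of_one_le₀ hM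
      rw [interp_apply, interp_apply, hx₀j k hk]
      nlinarith [mul_le_mul_of_nonneg_left h2 hs1,
        mul_nonneg (mul_nonneg hs.1 hxa) (sub_nonneg.2 hM')]
    have hc1 : interp w F s x k a ≤ ratioBd F i * interp w F s x k a := le_mul_of_one_le_left hy0 hM
    have hc2 : (ratioBd F i)⁻¹ * interp w F s x k a ≤ interp w F s x k a :=
      mul_le_of_le_one_left hy0 (inv_le_one_of_one_le₀ hM)
    simp only [Pi.add_apply, Pi.smul_apply, Pi.sub_apply, smul_eq_mul]
    have hu1 : 0 ≤ 1 - u := sub_nonneg.2 hu.2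
    constructor
    · nlinarith [mul_le_mul_of_nonneg_left hb2 hu.1, mul_le_mul_of_nonneg_left hc2 hu1]
    · nlinarith [mul_le_mul_of_nonneg_left hb1 hu.1, mul_le_mul_of_nonneg_left hc1 hu1]
  · have hterm : ∀ j, ∑ l', hessII F i l j l' (interp w F s x) (ratioBd F i) *
        |interp w F s x₀ j l' - interp w F s x j l'| ≤
        (⨆ j, Phi F j i x) * (∑ l', hessII F i l j l' (interp w F s x) (ratioBd F i) *
          interp w F s x j l') + if j = i then ∑ l', hessII F i l j l' (interp w F s x)
            (ratioBd F i) * interp w F s x j l' else 0 := by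
      intro j
      have hH : ∀ l', 0 ≤ hessII F i l j l' (interp w F s x) (ratioBd F i) := fun l' =>
        hessII_nonneg _ _ _ _ _ _ _
      rcases eq_or_ne j i with rfl | hj
      · rw [if_pos rfl]
        refine le_add_of_nonneg_of_le (mul_nonneg hP0 (Finset.sum_nonneg fun l' _ =>
          mul_nonneg (hH l') (hyc j l').1)) (Finset.sum_le_sum fun l' _ =>
            mul_le_mul_of_nonneg_left ?_ (hH l'))
        have hf0 := ((fitted_mem_relaxed hw hw1 F x).1 j l').1
        have hxa := (hxc j l').1
        have hz : x₀ j l' = 0 := by simp [hx₀, zeroRow]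
        rw [interp_apply, interp_apply, hfi, hz, abs_le]
        constructor <;> nlinarith [mul_nonneg hs.1 hxa, mul_nonneg hs1 hf0]
      · rw [if_neg hj, add_zero, Finset.mul_sum]
        refine Finset.sum_le_sum fun l' _ => ?_
        rw [mul_left_comm]
        refine mul_le_mul_of_nonneg_left ?_ (hH l')
        have hf0 := ((fitted_mem_relaxed hw hw1 F x).1 j l').1
        have hxa := (hxc j l').1
        have h1 := abs_fitted_zeroRow_sub_le hw hw1 hF z hj l'
        rw [← hx, ← hx₀] at h1
        have h2 : Phi F j i x ≤ ⨆ j, Phi F j i x := le_iSup_finite (fun j => Phi F j i x) j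
        rw [interp_apply, interp_apply, hx₀j j hj,
          show (1 - s) * fitted w F x₀ j l' + s * x j l' -
            ((1 - s) * fitted w F x j l' + s * x j l') =
            (1 - s) * (fitted w F x₀ j l' - fitted w F x j l') by ring, abs_mul, abs_of_nonneg hs1]
        calc (1 - s) * |fitted w F x₀ j l' - fitted w F x j l'|
            ≤ (1 - s) * (fitted w F x j l' * ⨆ j, Phi F j i x) :=
              mul_le_mul_of_nonneg_left (h1.trans (mul_le_mul_of_nonneg_left h2 hf0)) hs1
          _ ≤ _ := by nlinarith [mul_nonneg hP0 (mul_nonneg hs.1 hxa)]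
    refine (Finset.sum_le_sum fun j _ => hterm j).trans ?_
    rw [Finset.sum_add_distrib, ← Finset.mul_sum]
    simp

include hw hw1 in
/-- Under the Gibbs measure, the mean of `F` at the one-hot encoding exceeds the mean of `F` at the
fitted array by at most twice the smoothness term. -/
theorem sum_gibbsWeight_mul_sub_fitted_le (hF : ContDiffOn ℝ 2 F (cube K)) :
    ∑ z, gibbsWeight w F z * (F (oneHot z) - F (fitted w F (oneHot z))) ≤
      2 * smoothTerm F * ∑ z, gibbsWeight w F z := by
  have hG : DifferentiableOn ℝ F (cube K) := hF.differentiableOn (by norm_num)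
  have hgrad : ∀ s ∈ Set.Icc (0 : ℝ) 1, |∑ z, gibbsWeight w F z * ∑ i, ∑ l,
      (oneHot z - fitted w F (oneHot z)) i l * pderiv F i l (interp w F s (oneHot z))| ≤
      2 * smoothTerm F * ∑ z, gibbsWeight w F z := by
    intro s hs
    -- With row `i` erased the partial derivative no longer depends on `z i`, so each `i`-th
    -- contribution has conditional mean zero.
    have hzero : ∑ z, gibbsWeight w F z * ∑ i, ∑ l, (oneHot z - fitted w F (oneHot z)) i l *
        pderiv F i l (interp w F s (zeroRow (oneHot z) i)) = 0 := by
      simp only [Finset.mul_sum (s := (Finset.univ : Finset (Fin n)))]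
      rw [Finset.sum_comm]
      refine Finset.sum_eq_zero fun i _ => ?_
      exact sum_gibbsWeight_mul_oneHot_sub_fitted hw hw1 i
        (fun z l => pderiv F i l (interp w F s (zeroRow (oneHot z) i)))
        (fun z l => by simp only [zeroRow_update_oneHot])
    rw [← abs_neg, ← zero_sub, ← hzero, ← Finset.sum_sub_distrib, Finset.mul_sum]
    refine (Finset.abs_sum_le_sum_abs _ _).trans (Finset.sum_le_sum fun z _ => ?_)
    rw [← mul_sub, abs_mul, abs_of_nonneg (gibbsWeight_nonneg hw z), mul_comm]
    refine mul_le_mul_of_nonneg_right ?_ (gibbsWeight_nonneg hw z)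
    have hy := interp_mem_relaxed (F := F) hw hw1 (oneHot_mem_relaxed z) hs
    have hf := fitted_mem_relaxed hw hw1 F (oneHot z)
    rw [← Finset.sum_sub_distrib]
    refine (Finset.abs_sum_le_sum_abs _ _).trans ?_
    -- The factor `1 / 2` compensates for the `ℓ¹` distance between two probability vectors, which
    -- is at most `2`; this is the origin of the `2` in front of `smoothTerm`.
    have := sum_le_smoothTerm hF (oneHot_mem_relaxed z) hy (c := fun i => (1 / 2) *
      |∑ l, (oneHot z - fitted w F (oneHot z)) i l *
          pderiv F i l (interp w F s (zeroRow (oneHot z) i)) -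
        ∑ l, (oneHot z - fitted w F (oneHot z)) i l * pderiv F i l (interp w F s (oneHot z))|) ?_
    · rw [← Finset.mul_sum] at this; linarith
    · intro i
      set T : Fin (K i) → ℝ := fun l => (⨆ j, Phi F j i (oneHot z)) *
          (∑ j, ∑ l', hessII F i l j l' (interp w F s (oneHot z))
          (ratioBd F i) * interp w F s (oneHot z) j l') +
        ∑ l' : Fin (K i), hessII F i l i l' (interp w F s (oneHot z)) (ratioBd F i) *
          interp w F s (oneHot z) i l' with hT
      rw [← Finset.sum_sub_distrib]
      have h1 : |∑ l, ((oneHot z - fitted w F (oneHot z)) i l *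
          pderiv F i l (interp w F s (zeroRow (oneHot z) i)) -
          (oneHot z - fitted w F (oneHot z)) i l * pderiv F i l (interp w F s (oneHot z)))| ≤
          ∑ l, (oneHot z i l + fitted w F (oneHot z) i l) * ⨆ l, T l := by
        refine (Finset.abs_sum_le_sum_abs _ _).trans (Finset.sum_le_sum fun l _ => ?_)
        rw [← mul_sub, abs_mul]
        have hx0 := ((oneHot_mem_relaxed z).1 i l).1
        have hf0 := (hf.1 i l).1
        refine mul_le_mul ?_ ((abs_pderiv_interp_sub_le hw hw1 hF z i l hs).trans
          (le_iSup_finite T l)) (abs_nonneg _) (add_nonneg hx0 hf0)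
        simp only [Pi.sub_apply]
        rw [abs_le]; constructor <;> linarith
      rw [← Finset.sum_mul, Finset.sum_add_distrib, (oneHot_mem_relaxed z).2 i, hf.2 i] at h1
      linarith
  have hline : ∀ z : Loc K, ∀ s ∈ Set.Icc (0 : ℝ) 1,
      fitted w F (oneHot z) + s • (oneHot z - fitted w F (oneHot z)) ∈ cube K := fun z s hs =>
    interp_mem_cube hw hw1 (oneHot_mem_relaxed z).1 hs
  -- The mean value inequality is applied to the Gibbs average, because the cancellation in the
  -- derivative occurs only after averaging.
  have key := norm_image_sub_le_of_norm_deriv_le_segment_01'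
    (f := fun s : ℝ => ∑ z, gibbsWeight w F z *
      F (fitted w F (oneHot z) + s • (oneHot z - fitted w F (oneHot z))))
    (C := 2 * smoothTerm F * ∑ z, gibbsWeight w F z)
    (fun s hs => HasDerivWithinAt.fun_sum fun z _ =>
      (hasDerivWithinAt_line hG (hline z) hs).const_mul (gibbsWeight w F z))
    (fun s hs => hgrad s ⟨hs.1, hs.2.le⟩)
  simp only [one_smul, zero_smul, add_zero, add_sub_cancel, Real.norm_eq_abs] at key
  rw [← Finset.sum_sub_distrib] at key
  simp only [mul_sub]
  exact (le_abs_self _).trans key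

include hw hw1 in
/-- Nonlinear large deviation bound: the log-partition function is at most the largest value of
`F - I` at fitted arrays, up to the smoothness and complexity terms. -/
theorem exists_log_sum_gibbsWeight_le (hF : ContDiffOn ℝ 2 F (cube K)) {ε : ℝ}
    {D : Finset (Arr K)} (hD : IsGradientNet F ε D) :
    ∃ z, Real.log (∑ z, gibbsWeight w F z) ≤
      F (fitted w F (oneHot z)) - ∑ i, ∑ l, fitted w F (oneHot z) i l *
        (rowIncr F (oneHot z) i l - logLaplace (w i) (rowIncr F (oneHot z) i)) +
      (2 * smoothTerm F + complexityTerm ε D) := by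
  choose! σ hσ hσε using hD
  have h1 := log_sum_gibbsWeight_le (F := F) hw hw1 D (fun z => σ (oneHot z))
    (fun z => hσ _ (oneHot_mem_relaxed z))
  set S := ∑ z, gibbsWeight w F z with hS
  have hSpos : 0 < S := sum_gibbsWeight_pos hw hw1 F
  -- The fitted log-likelihood of row `i`, as a function of its value, is determined by the other
  -- rows; conditioning on them replaces the sampled value by its mean under the fitted law.
  have hent : ∑ z, gibbsWeight w F z *
      ∑ i, (rowIncr F (oneHot z) i (z i) - logLaplace (w i) (rowIncr F (oneHot z) i)) =
      ∑ z, gibbsWeight w F z * ∑ i, ∑ l, fitted w F (oneHot z) i l *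
        (rowIncr F (oneHot z) i l - logLaplace (w i) (rowIncr F (oneHot z) i)) := by
    simp only [Finset.mul_sum (s := (Finset.univ : Finset (Fin n)))]
    rw [Finset.sum_comm, Finset.sum_comm (s := (Finset.univ : Finset (Loc K)))]
    refine Finset.sum_congr rfl fun i _ => ?_
    have := sum_gibbsWeight_mul_oneHot_sub_fitted (F := F) hw hw1 i
      (fun z l => rowIncr F (oneHot z) i l - logLaplace (w i) (rowIncr F (oneHot z) i))
      (fun z l => by simp only [rowIncr_update_oneHot])
    have h2 : ∀ z, ∑ l, oneHot z i l * (rowIncr F (oneHot z) i l -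
        logLaplace (w i) (rowIncr F (oneHot z) i)) =
        rowIncr F (oneHot z) i (z i) - logLaplace (w i) (rowIncr F (oneHot z) i) := fun z => by
      simp [oneHot]
    simp only [sub_mul (oneHot _ _ _), Finset.sum_sub_distrib, h2, mul_sub (gibbsWeight w F _)] at this
    simp only [mul_sub (gibbsWeight w F _), Finset.sum_sub_distrib]
    linarith
  -- One `ε` comes from the increments and one from `logLaplace`, which is 1-Lipschitz in the
  -- maximum norm.
  have hnet : ∀ z, -∑ i, (σ (oneHot z) i (z i) - logLaplace (w i) (σ (oneHot z) i)) ≤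
      -∑ i, (rowIncr F (oneHot z) i (z i) - logLaplace (w i) (rowIncr F (oneHot z) i)) + 2 * ε := by
    intro z
    have hz := hσε (oneHot z) (oneHot_mem_relaxed z)
    have : ∑ i, ((rowIncr F (oneHot z) i (z i) - logLaplace (w i) (rowIncr F (oneHot z) i)) -
        (σ (oneHot z) i (z i) - logLaplace (w i) (σ (oneHot z) i))) ≤
        ∑ i, 2 * ⨆ l : Fin (K i), |F (setRow (oneHot z) i l) - F (zeroRow (oneHot z) i) -
          σ (oneHot z) i l| := by
      refine Finset.sum_le_sum fun i _ => ?_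
      set a := ⨆ l : Fin (K i), |F (setRow (oneHot z) i l) - F (zeroRow (oneHot z) i) -
          σ (oneHot z) i l| with ha
      have hl : ∀ l, |rowIncr F (oneHot z) i l - σ (oneHot z) i l| ≤ a := fun l =>
        le_iSup_finite (fun l => |F (setRow (oneHot z) i l) - F (zeroRow (oneHot z) i) -
          σ (oneHot z) i l|) l
      have h3 := logLaplace_le_add (hw i) (hw1 i) (u := σ (oneHot z) i)
        (v := rowIncr F (oneHot z) i) (a := a) fun l => by linarith [(abs_le.1 (hl l)).1]
      linarith [(abs_le.1 (hl (z i))).2]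
    rw [Finset.sum_sub_distrib, ← Finset.mul_sum] at this
    linarith
  have hle : ∑ z, gibbsWeight w F z * (F (oneHot z) -
        ∑ i, (σ (oneHot z) i (z i) - logLaplace (w i) (σ (oneHot z) i))) ≤
      ∑ z, gibbsWeight w F z * (F (fitted w F (oneHot z)) - ∑ i, ∑ l, fitted w F (oneHot z) i l *
        (rowIncr F (oneHot z) i l - logLaplace (w i) (rowIncr F (oneHot z) i))) +
      S * (2 * smoothTerm F + 2 * ε) := by
    have h2 := sum_gibbsWeight_mul_sub_fitted_le hw hw1 hF
    have h3 := Finset.sum_le_sum fun z (_ : z ∈ Finset.univ) =>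
      mul_le_mul_of_nonneg_left (hnet z) (gibbsWeight_nonneg (F := F) hw z)
    simp only [mul_add, mul_neg, Finset.sum_add_distrib, Finset.sum_neg_distrib] at h3
    rw [hent, ← Finset.sum_mul] at h3
    simp only [mul_sub, Finset.sum_sub_distrib] at h2 h3 ⊢
    linarith
  -- If the bound failed at every `z`, its Gibbs average would fail strictly.
  by_contra! hcon
  have hlt : ∑ z, gibbsWeight w F z * (F (fitted w F (oneHot z)) -
      ∑ i, ∑ l, fitted w F (oneHot z) i l *
        (rowIncr F (oneHot z) i l - logLaplace (w i) (rowIncr F (oneHot z) i)) +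
        (2 * smoothTerm F + complexityTerm ε D)) < ∑ z, gibbsWeight w F z * Real.log S := by
    obtain ⟨z, -, hz⟩ := Finset.exists_ne_zero_of_sum_ne_zero hSpos.ne'
    exact Finset.sum_lt_sum (fun z _ => mul_le_mul_of_nonneg_left (hcon z).le
      (gibbsWeight_nonneg hw z)) ⟨z, Finset.mem_univ _, mul_lt_mul_of_pos_left (hcon z)
        ((gibbsWeight_nonneg hw z).lt_of_ne' hz)⟩
  simp only [mul_add (gibbsWeight w F _), Finset.sum_add_distrib, ← Finset.sum_mul, ← hS] at hlt
  rw [complexityTerm] at hlt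
  linarith

end Smoothness

end MeanFieldVI

namespace MeanFieldVI

/-! ### Second-order Taylor estimates and independent random rows. -/

section Taylor

variable {n : ℕ} {K : Fin n → ℕ}

theorem sub_sub_deriv_le_half {φ φ' : ℝ → ℝ} {M : ℝ}
    (hφ : ∀ s ∈ Set.Icc (0 : ℝ) 1, HasDerivWithinAt φ (φ' s) (Set.Icc 0 1) s)
    (hM : ∀ s ∈ Set.Icc (0 : ℝ) 1, |φ' s - φ' 0| ≤ M * s) :
    |φ 1 - φ 0 - φ' 0| ≤ M / 2 := by
  have h1 : ∀ s ∈ Set.Icc (0 : ℝ) 1, HasDerivWithinAt (fun s => φ s - φ 0 - φ' 0 * s)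
      (φ' s - φ' 0) (Set.Icc 0 1) s := fun s hs => by
    simpa using ((hφ s hs).sub_const (φ 0)).fun_sub
      ((hasDerivWithinAt_id s (Set.Icc (0 : ℝ) 1)).const_mul (φ' 0))
  have := image_norm_le_of_norm_deriv_right_le_deriv_boundary (a := (0 : ℝ)) (b := 1)
    (f := fun s => φ s - φ 0 - φ' 0 * s) (f' := fun s => φ' s - φ' 0)
    (B := fun s => M * s ^ 2 / 2) (B' := fun s => M * s)
    (fun s hs => (h1 s hs).continuousWithinAt)
    (fun s hs => ((h1 s ⟨hs.1, hs.2.le⟩).mono_of_mem_nhdsWithin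
      (Icc_mem_nhdsGE_of_mem hs)))
    (by simp)
    (fun s => (((hasDerivAt_pow 2 s).const_mul M).div_const 2).congr_deriv (by norm_num; ring))
    (fun s hs => hM s ⟨hs.1, hs.2.le⟩) (x := 1) (by simp)
  simpa using this

/-- Second-order Taylor estimate when one row is replaced by a canonical vector. -/
theorem le_setRow_of_pderiv2_le {G : Arr K → ℝ} (hG : ContDiffOn ℝ 2 G (cube K)) {i : Fin n}
    {e : ℝ} (he : ∀ l l', ∀ y ∈ cube K, |pderiv2 G i l i l' y| ≤ e) {x : Arr K}
    (hx : x ∈ cube K) (hxi : ∑ l, x i l = 1) (l : Fin (K i)) :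
    G x + ∑ l', ((if l' = l then 1 else 0) - x i l') * pderiv G i l' x - 2 * e ≤
      G (setRow x i l) := by
  have he0 : 0 ≤ e := (abs_nonneg _).trans (he l l x hx)
  set x' := setRow x i l with hx'
  have hx'c : x' ∈ cube K := setRow_mem_cube hx i l
  have hline : ∀ s ∈ Set.Icc (0 : ℝ) 1, x + s • (x' - x) ∈ cube K :=
    fun s hs => line_mem_cube hx hx'c hs
  have hw : ∀ i' l', (x' - x) i' l' = if i' = i then (x' - x) i' l' else 0 := by
    intro i' l'
    split_ifs with h
    · rfl
    · simp [hx', setRow, h]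
  have hwi : ∀ l', (x' - x) i l' = (if l' = l then 1 else 0) - x i l' := fun l' => by
    simp [hx', setRow, Pi.single_apply]
  have hsum : ∀ y : Arr K, ∑ i', ∑ l', (x' - x) i' l' * pderiv G i' l' y =
      ∑ l', (x' - x) i l' * pderiv G i l' y := fun y =>
    Finset.sum_eq_single i (fun i' _ h => Finset.sum_eq_zero fun l' _ => by
      rw [hw, if_neg h, zero_mul]) (by simp)
  have hl1 : ∑ l', |(x' - x) i l'| ≤ 2 := by
    calc ∑ l', |(x' - x) i l'| ≤ ∑ l', ((if l' = l then 1 else 0) + x i l') :=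
          Finset.sum_le_sum fun l' _ => by
            rw [hwi]
            refine (abs_sub _ _).trans (le_of_eq ?_)
            rw [abs_of_nonneg (hx i l').1, abs_of_nonneg (by split_ifs <;> norm_num)]
      _ = 2 := by rw [Finset.sum_add_distrib, hxi]; simp; norm_num
  -- The displacement has `ℓ¹` norm at most `2` and enters twice, in the variation of the gradient
  -- and in its pairing; this gives `4e`, halved by the Taylor estimate.
  have key := sub_sub_deriv_le_half (φ := fun s : ℝ => G (x + s • (x' - x))) (M := 4 * e)
    (fun s hs => hasDerivWithinAt_line (hG.differentiableOn (by norm_num)) hline hs) (by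
      intro s hs
      rw [hsum, hsum, zero_smul, add_zero, ← Finset.sum_sub_distrib]
      refine (Finset.abs_sum_le_sum_abs _ _).trans ?_
      have h1 : ∀ l', |pderiv G i l' (x + s • (x' - x)) - pderiv G i l' x| ≤ 2 * e * s := by
        intro l'
        refine (abs_sub_le_sum_pderiv ((contDiffOn_pderiv hG i l').differentiableOn one_ne_zero)
          hx (hline s hs) (fun i' l'' => if i' = i then e else 0) ?_).trans ?_
        · intro u hu i' l'' hne
          have hi' : i' = i := by
            by_contra h
            apply hne
            have := hw i' l''
            rw [if_neg h] at this
            simp only [Pi.add_apply, Pi.smul_apply, this, smul_zero, add_zero]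
          subst hi'
          rw [if_pos rfl]
          exact he l' l'' _ (line_mem_cube hx (hline s hs) hu)
        · rw [Finset.sum_eq_single i (fun i' _ h => by simp [h]) (by simp)]
          simp only [if_true, Pi.add_apply, Pi.smul_apply, add_sub_cancel_left, smul_eq_mul,
            abs_mul, abs_of_nonneg hs.1, ← Finset.mul_sum]
          nlinarith [mul_le_mul_of_nonneg_left hl1 (mul_nonneg he0 hs.1)]
      calc _ ≤ ∑ l', |(x' - x) i l'| * (2 * e * s) := Finset.sum_le_sum fun l' _ => by
            rw [← mul_sub, abs_mul]
            exact mul_le_mul_of_nonneg_left (h1 l') (abs_nonneg _)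
        _ ≤ 4 * e * s := by
          rw [← Finset.sum_mul]
          nlinarith [mul_le_mul_of_nonneg_right hl1 (mul_nonneg he0 hs.1)])
  rw [hsum] at key
  simp only [one_smul, zero_smul, add_zero, add_sub_cancel, hwi] at key
  linarith [(abs_le.1 key).1]

/-- One-hot rows on `A`, rows of `y` elsewhere. -/
def mixRows (y : Arr K) (A : Finset (Fin n)) (z : Loc K) : Arr K :=
  fun i => if i ∈ A then oneHot z i else y i

theorem mixRows_mem_relaxed {y : Arr K} (hy : y ∈ relaxed K) (A : Finset (Fin n)) (z : Loc K) :
    mixRows y A z ∈ relaxed K := by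
  have hz := oneHot_mem_relaxed z
  refine ⟨fun i l => ?_, fun i => ?_⟩ <;> by_cases h : i ∈ A <;> simp only [mixRows, h, if_true, if_false]
  exacts [hz.1 i l, hy.1 i l, hz.2 i, hy.2 i]

theorem gibbsWeight_zero (y : Arr K) (z : Loc K) : gibbsWeight y 0 z = ∏ i, y i (z i) := by
  simp [gibbsWeight]

theorem sum_prod_eq_one {y : Arr K} (hy : y ∈ relaxed K) : ∑ z : Loc K, ∏ i, y i (z i) = 1 := by
  rw [← Fintype.prod_sum]
  exact Finset.prod_eq_one fun i _ => hy.2 i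

/-- The case of zero Hamiltonian: the Gibbs measure is the product measure with marginals `y`, and
the fitted array is `y` itself. -/
theorem sum_prod_mul_resample {y : Arr K} (hy : y ∈ relaxed K) (i : Fin n)
    (h : Loc K → Fin (K i) → ℝ) (hh : ∀ z l, h (Function.update z i l) = h z) :
    ∑ z : Loc K, (∏ i, y i (z i)) * h z (z i) =
      ∑ z : Loc K, (∏ i, y i (z i)) * ∑ l, y i l * h z l := by
  have hf : ∀ x, fitted y 0 x i = y i := fun x => by
    ext l; simp [fitted, rowGibbs, rowIncr, hy.2 i]
  have := sum_gibbsWeight_mul_oneHot_sub_fitted (F := 0) (fun i l => (hy.1 i l).1) hy.2 i h hh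
  have h2 : ∀ z, ∑ l, oneHot z i l * h z l = h z (z i) := fun z => by simp [oneHot]
  simp only [gibbsWeight_zero, hf, sub_mul, Finset.sum_sub_distrib, h2, mul_sub] at this
  linarith

/-- Replacing the mean `y` of independent one-hot rows by the random rows themselves changes the
mean of `G` by at most twice the sum of the diagonal Hessian bounds. -/
theorem le_sum_prod_mul_oneHot {G : Arr K → ℝ} (hG : ContDiffOn ℝ 2 G (cube K)) {e : Fin n → ℝ}
    (he : ∀ i l l', ∀ y ∈ cube K, |pderiv2 G i l i l' y| ≤ e i) {y : Arr K}
    (hy : y ∈ relaxed K) :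
    G y ≤ ∑ z : Loc K, (∏ i, y i (z i)) * G (oneHot z) + 2 * ∑ i, e i := by
  have main : ∀ A : Finset (Fin n),
      G y ≤ ∑ z : Loc K, (∏ i, y i (z i)) * G (mixRows y A z) + 2 * ∑ i ∈ A, e i := by
    intro A
    induction A using Finset.induction_on with
    | empty =>
      have : ∀ z, mixRows y ∅ z = y := fun z => by ext; simp [mixRows]
      simp [this, ← Finset.sum_mul, sum_prod_eq_one hy]
    | insert a A ha ih =>
      have hmix : ∀ z, mixRows y (insert a A) z = setRow (mixRows y A z) a (z a) := by
        intro z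
        ext i l
        rcases eq_or_ne i a with rfl | h
        · simp [mixRows, setRow, oneHot, Pi.single_apply, eq_comm]
        · simp [mixRows, setRow, h]
      have hupd : ∀ z l, mixRows y A (Function.update z a l) = mixRows y A z := by
        intro z l
        ext i l'
        by_cases h : i ∈ A
        · have : i ≠ a := fun h' => ha (h' ▸ h)
          simp only [mixRows, if_pos h, oneHot, Function.update_of_ne this]
        · simp [mixRows, h]
      have hstep : ∀ z, G (mixRows y A z) ≤
          ∑ l, y a l * G (setRow (mixRows y A z) a l) + 2 * e a := by
        intro z
        set x := mixRows y A z with hx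
        have hxa : x a = y a := by simp [hx, mixRows, ha]
        have hxr := mixRows_mem_relaxed hy A z
        have h1 := Finset.sum_le_sum fun l (_ : l ∈ Finset.univ) => mul_le_mul_of_nonneg_left
          (le_setRow_of_pderiv2_le hG (he a) hxr.1 (hxr.2 a) l) (hy.1 a l).1
        -- The canonical vectors average to row `a` of `y` under the weights `y a l`, so the
        -- first-order terms cancel.
        have h2 : ∑ l, y a l * (G x + ∑ l', ((if l' = l then 1 else 0) - x a l') * pderiv G a l' x
            - 2 * e a) = G x - 2 * e a := by
          simp only [mul_sub, mul_add, sub_mul, Finset.sum_sub_distrib, Finset.sum_add_distrib,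
            ← Finset.sum_mul, hy.2 a, hxa]
          simp
        rw [← hx, h2] at h1
        linarith
      have hsum := Finset.sum_le_sum fun z (_ : z ∈ Finset.univ) =>
        mul_le_mul_of_nonneg_left (hstep z)
          (Finset.prod_nonneg fun i _ => (hy.1 i (z i)).1 : 0 ≤ ∏ i, y i (z i))
      simp only [mul_add (∏ i, y i _), Finset.sum_add_distrib, ← Finset.sum_mul,
        sum_prod_eq_one hy, one_mul] at hsum
      rw [← sum_prod_mul_resample hy a (fun z l => G (setRow (mixRows y A z) a l))
        (fun z l => by simp only [hupd])] at hsum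
      simp only [hmix]
      rw [Finset.sum_insert ha]
      linarith
  have h := main Finset.univ
  have : ∀ z, mixRows y Finset.univ z = oneHot z := fun z => by ext; simp [mixRows]
  simpa only [this] using h

theorem sum_prod_mul_sum {y : Arr K} (hy : y ∈ relaxed K) (g : ∀ i, Fin (K i) → ℝ) :
    ∑ z : Loc K, (∏ i, y i (z i)) * ∑ i, g i (z i) = ∑ i, ∑ l, y i l * g i l := by
  simp only [Finset.mul_sum (s := (Finset.univ : Finset (Fin n)))]
  rw [Finset.sum_comm]
  refine Finset.sum_congr rfl fun i _ => ?_
  rw [sum_prod_mul_resample hy i (fun _ l => g i l) (fun _ _ => rfl), ← Finset.sum_mul,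
    sum_prod_eq_one hy, one_mul]

end Taylor

end MeanFieldVI

namespace MeanFieldVI

/-! ### Product densities and a conditional bound on the Kullback-Leibler divergence. -/

section Measure

theorem lintegral_pi_prod {ι : Type*} [Fintype ι] {E : ι → Type*} [∀ i, MeasurableSpace (E i)]
    (ν : ∀ i, Measure (E i)) [∀ i, IsProbabilityMeasure (ν i)] {f : ∀ i, E i → ℝ≥0∞}
    (hf : ∀ i, Measurable (f i)) :
    ∫⁻ θ, ∏ i, f i (θ i) ∂(Measure.pi ν) = ∏ i, ∫⁻ x, f i x ∂(ν i) := by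
  refine (ProbabilityTheory.lintegral_prod_eq_prod_lintegral_of_indepFun Finset.univ
    (fun i (θ : ∀ i, E i) => f i (θ i))
    (ProbabilityTheory.iIndepFun_pi fun i => (hf i).aemeasurable)
    (fun i => (hf i).comp (measurable_pi_apply i))).trans ?_
  exact Finset.prod_congr rfl fun i _ =>
    (measurePreserving_eval ν i).lintegral_comp (hf i)

theorem isProbabilityMeasure_withDensity {α : Type*} [MeasurableSpace α] {ν : Measure α}
    {f : α → ℝ≥0∞} (h : ∫⁻ x, f x ∂ν = 1) : IsProbabilityMeasure (ν.withDensity f) :=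
  ⟨by rw [withDensity_apply _ MeasurableSet.univ, Measure.restrict_univ, h]⟩

theorem pi_withDensity {ι : Type*} [Fintype ι] {E : ι → Type*} [∀ i, MeasurableSpace (E i)]
    (ν : ∀ i, Measure (E i)) [∀ i, IsProbabilityMeasure (ν i)] {f : ∀ i, E i → ℝ≥0∞}
    (hf : ∀ i, Measurable (f i)) (hf1 : ∀ i, ∫⁻ x, f i x ∂(ν i) = 1) :
    Measure.pi (fun i => (ν i).withDensity (f i)) =
      (Measure.pi ν).withDensity fun θ => ∏ i, f i (θ i) := by
  have : ∀ i, IsProbabilityMeasure ((ν i).withDensity (f i)) := fun i =>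
    isProbabilityMeasure_withDensity (hf1 i)
  refine Measure.pi_eq fun s hs => ?_
  rw [withDensity_apply _ (MeasurableSet.univ_pi hs), ← lintegral_indicator (MeasurableSet.univ_pi hs)]
  have h1 : ∀ θ : ∀ i, E i, (Set.univ.pi s).indicator (fun θ => ∏ i, f i (θ i)) θ =
      ∏ i, (s i).indicator (f i) (θ i) := by
    intro θ
    by_cases h : θ ∈ Set.univ.pi s
    · rw [Set.indicator_of_mem h]
      exact Finset.prod_congr rfl fun i _ => (Set.indicator_of_mem (h i (Set.mem_univ i)) _).symm
    · rw [Set.indicator_of_notMem h]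
      simp only [Set.mem_pi, Set.mem_univ, true_implies, not_forall] at h
      obtain ⟨i, hi⟩ := h
      exact (Finset.prod_eq_zero (Finset.mem_univ i) (Set.indicator_of_notMem hi _)).symm
  simp only [h1]
  rw [lintegral_pi_prod ν fun i => (hf i).indicator (hs i)]
  exact Finset.prod_congr rfl fun i _ => by
    rw [lintegral_indicator (hs i), withDensity_apply _ (hs i)]

variable {Θ Ω : Type*} [MeasurableSpace Θ] [MeasurableSpace Ω] [Fintype Ω]
  {ν : Measure Θ} {π : Measure Ω}

theorem lintegral_prod_fintype [MeasurableSingletonClass Ω] [IsFiniteMeasure π] {g : Θ × Ω → ℝ} (hg : Measurable g) (hg0 : ∀ x, 0 ≤ g x) :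
    ∫⁻ x, ENNReal.ofReal (g x) ∂(ν.prod π) =
      ∫⁻ θ, ENNReal.ofReal (∑ z, π.real {z} * g (θ, z)) ∂ν := by
  rw [lintegral_prod _ hg.ennreal_ofReal.aemeasurable]
  refine lintegral_congr fun θ => ?_
  rw [lintegral_fintype, ENNReal.ofReal_sum_of_nonneg fun z _ =>
    mul_nonneg measureReal_nonneg (hg0 _)]
  refine Finset.sum_congr rfl fun z _ => ?_
  rw [ENNReal.ofReal_mul measureReal_nonneg, ofReal_measureReal, mul_comm]

theorem measurable_sum_mul_real {g : Θ × Ω → ℝ} (hg : Measurable g) :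
    Measurable fun θ => ∑ z, π.real {z} * g (θ, z) :=
  Finset.measurable_sum _ fun _ _ => (hg.comp (measurable_id.prodMk measurable_const)).const_mul _

theorem integrable_and_integral_of_lintegral_eq_one {q : Θ → ℝ} (hq : Measurable q)
    (hq0 : ∀ x, 0 ≤ q x) (h : ∫⁻ x, ENNReal.ofReal (q x) ∂ν = 1) :
    Integrable q ν ∧ ∫ x, q x ∂ν = 1 := by
  refine ⟨⟨hq.aestronglyMeasurable, ?_⟩, ?_⟩
  · rw [hasFiniteIntegral_iff_ofReal (Filter.Eventually.of_forall hq0), h]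
    exact ENNReal.one_lt_top
  · rw [integral_eq_lintegral_of_nonneg_ae (Filter.Eventually.of_forall hq0)
      hq.aestronglyMeasurable, h, ENNReal.toReal_one]

/-- If the conditional mean of the log-likelihood ratio given the first component is at most `B`,
then so is the Kullback-Leibler divergence. -/
theorem klDiv_withDensity_le [MeasurableSingletonClass Ω] [IsProbabilityMeasure ν]
    [IsProbabilityMeasure π] {ρ γ : Θ × Ω → ℝ} (hρ : Measurable ρ) (hγ : Measurable γ)
    (hρ0 : ∀ x, 0 < ρ x) (hγ0 : ∀ x, 0 ≤ γ x)
    (hρ1 : ∫⁻ x, ENNReal.ofReal (ρ x) ∂(ν.prod π) = 1)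
    (hγ1 : ∫⁻ x, ENNReal.ofReal (γ x) ∂(ν.prod π) = 1) {B : ℝ}
    (hB : ∀ᵐ θ ∂ν, ∑ z, π.real {z} * (γ (θ, z) * Real.log (γ (θ, z) / ρ (θ, z))) ≤
      B * ∑ z, π.real {z} * γ (θ, z)) :
    0 ≤ B ∧ klDiv ((ν.prod π).withDensity fun x => ENNReal.ofReal (γ x))
      ((ν.prod π).withDensity fun x => ENNReal.ofReal (ρ x)) ≤ ENNReal.ofReal B := by
  have : IsProbabilityMeasure ((ν.prod π).withDensity fun x => ENNReal.ofReal (ρ x)) :=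
    isProbabilityMeasure_withDensity hρ1
  have : IsProbabilityMeasure ((ν.prod π).withDensity fun x => ENNReal.ofReal (γ x)) :=
    isProbabilityMeasure_withDensity hγ1
  set Q := (ν.prod π).withDensity fun x => ENNReal.ofReal (ρ x) with hQ
  have hquot : Measurable fun x => ENNReal.ofReal (γ x / ρ x) := (hγ.div hρ).ennreal_ofReal
  have hP : ((ν.prod π).withDensity fun x => ENNReal.ofReal (γ x)) =
      Q.withDensity fun x => ENNReal.ofReal (γ x / ρ x) := by
    rw [hQ, ← withDensity_mul _ hρ.ennreal_ofReal hquot]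
    congr 1
    ext x
    rw [Pi.mul_apply, ← ENNReal.ofReal_mul (hρ0 x).le, mul_div_cancel₀ _ (hρ0 x).ne']
  have hlog : Measurable fun x => γ x * Real.log (γ x / ρ x) + ρ x - γ x :=
    ((hγ.mul (hγ.div hρ).log).add hρ).sub hγ
  have hkl : ∀ x, ρ x * klFun (γ x / ρ x) = γ x * Real.log (γ x / ρ x) + ρ x - γ x := by
    intro x
    have := (hρ0 x).ne'
    rw [klFun_apply]; field_simp
  have hnn : ∀ x, 0 ≤ γ x * Real.log (γ x / ρ x) + ρ x - γ x := fun x => by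
    rw [← hkl]
    exact mul_nonneg (hρ0 x).le (klFun_nonneg (div_nonneg (hγ0 x) (hρ0 x).le))
  -- The correction `ρ - γ` makes the integrand nonnegative, so integrability of the log-ratio need
  -- not be known in advance; it integrates to zero because both densities have mass one.
  have hklDiv : klDiv ((ν.prod π).withDensity fun x => ENNReal.ofReal (γ x)) Q =
      ∫⁻ x, ENNReal.ofReal (γ x * Real.log (γ x / ρ x) + ρ x - γ x) ∂(ν.prod π) := by
    rw [klDiv_eq_lintegral_klFun_of_ac (by rw [hP]; exact withDensity_absolutelyContinuous _ _)]
    have h1 : ((ν.prod π).withDensity fun x => ENNReal.ofReal (γ x)).rnDeriv Q =ᵐ[Q]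
        fun x => ENNReal.ofReal (γ x / ρ x) := by
      rw [hP]; exact Measure.rnDeriv_withDensity Q hquot
    have h2 : ∫⁻ x, ENNReal.ofReal (klFun
        ((((ν.prod π).withDensity fun x => ENNReal.ofReal (γ x)).rnDeriv Q x).toReal)) ∂Q =
        ∫⁻ x, ENNReal.ofReal (klFun (γ x / ρ x)) ∂Q :=
      lintegral_congr_ae (h1.mono fun x hx => by
        simp only [hx, ENNReal.toReal_ofReal (div_nonneg (hγ0 x) (hρ0 x).le)])
    have h3 : Measurable fun x => ENNReal.ofReal (klFun (γ x / ρ x)) :=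
      (measurable_klFun.comp (hγ.div hρ)).ennreal_ofReal
    rw [h2, hQ, lintegral_withDensity_eq_lintegral_mul _ hρ.ennreal_ofReal h3]
    refine lintegral_congr fun x => ?_
    rw [Pi.mul_apply, ← ENNReal.ofReal_mul (hρ0 x).le, hkl]
  set q : Θ → ℝ := fun θ => ∑ z, π.real {z} * γ (θ, z) with hq
  set p : Θ → ℝ := fun θ => ∑ z, π.real {z} * ρ (θ, z) with hp
  rw [lintegral_prod_fintype hγ hγ0] at hγ1
  rw [lintegral_prod_fintype hρ fun x => (hρ0 x).le] at hρ1
  obtain ⟨hqi, hq1⟩ := integrable_and_integral_of_lintegral_eq_one (measurable_sum_mul_real hγ)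
    (fun θ => Finset.sum_nonneg fun z _ => mul_nonneg measureReal_nonneg (hγ0 _)) hγ1
  obtain ⟨hpi, hp1⟩ := integrable_and_integral_of_lintegral_eq_one (measurable_sum_mul_real hρ)
    (fun θ => Finset.sum_nonneg fun z _ => mul_nonneg measureReal_nonneg (hρ0 _).le) hρ1
  have hsum : ∀ θ, ∑ z, π.real {z} * (γ (θ, z) * Real.log (γ (θ, z) / ρ (θ, z)) + ρ (θ, z) -
      γ (θ, z)) = ∑ z, π.real {z} * (γ (θ, z) * Real.log (γ (θ, z) / ρ (θ, z))) + p θ - q θ := by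
    intro θ
    simp only [hp, hq, mul_sub, mul_add, Finset.sum_sub_distrib, Finset.sum_add_distrib]
  have hle : ∀ᵐ θ ∂ν, ∑ z, π.real {z} * (γ (θ, z) * Real.log (γ (θ, z) / ρ (θ, z)) + ρ (θ, z) -
      γ (θ, z)) ≤ B * q θ + p θ - q θ := hB.mono fun θ h => by rw [hsum]; linarith
  have hnn' : ∀ᵐ θ ∂ν, 0 ≤ B * q θ + p θ - q θ := hle.mono fun θ h => le_trans
    (Finset.sum_nonneg fun z _ => mul_nonneg measureReal_nonneg (hnn _)) h
  have hadd : Integrable (fun θ => B * q θ + p θ) ν := (hqi.const_mul B).add hpi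
  have hint : Integrable (fun θ => B * q θ + p θ - q θ) ν := hadd.sub hqi
  have hval : ∫ θ, (B * q θ + p θ - q θ) ∂ν = B := by
    rw [integral_sub hadd hqi, integral_add (hqi.const_mul B) hpi, integral_const_mul, hq1, hp1]
    ring
  refine ⟨hval ▸ integral_nonneg_of_ae hnn', ?_⟩
  rw [hklDiv, lintegral_prod_fintype hlog hnn, ← hval,
    ofReal_integral_eq_lintegral_ofReal hint hnn']
  exact lintegral_mono_ae (hle.mono fun θ h => ENNReal.ofReal_le_ofReal h)

end Measure

end MeanFieldVI

namespace MeanFieldVI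

/-! ### Relative entropy: extended-valued and real-valued forms. -/

section Entropy

variable {n : ℕ} {K : Fin n → ℕ} {μ : ∀ i : Fin n, Measure (Fin (K i))}

/-- The array of probability weights of the reference measures. -/
noncomputable def refWeights (μ : ∀ i : Fin n, Measure (Fin (K i))) : Arr K :=
  fun i l => (μ i).real {l}

/-- The real-valued relative entropy. -/
noncomputable def relEntropyReal (μ : ∀ i : Fin n, Measure (Fin (K i))) (y : Arr K) : ℝ :=
  ∑ i, ∑ l, y i l * Real.log (y i l / refWeights μ i l)

theorem EReal_coe_sum {ι : Type*} (s : Finset ι) (f : ι → ℝ) :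
    ((∑ i ∈ s, f i : ℝ) : EReal) = ∑ i ∈ s, (f i : EReal) := by
  classical
  induction s using Finset.induction_on with
  | empty => simp
  | insert a s ha ih => rw [Finset.sum_insert ha, Finset.sum_insert ha, EReal.coe_add, ih]

theorem EReal_sum_ne_bot {ι : Type*} (s : Finset ι) {f : ι → EReal} (h : ∀ i ∈ s, f i ≠ ⊥) :
    ∑ i ∈ s, f i ≠ ⊥ := by
  classical
  induction s using Finset.induction_on with
  | empty => simp
  | insert a s ha ih =>
    rw [Finset.sum_insert ha, Ne, EReal.add_eq_bot_iff, not_or]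
    exact ⟨h a (Finset.mem_insert_self a s), ih fun i hi => h i (Finset.mem_insert_of_mem hi)⟩

theorem EReal_sum_eq_top {ι : Type*} [Fintype ι] {f : ι → EReal} (h : ∀ i, f i ≠ ⊥) {a : ι}
    (ha : f a = ⊤) : ∑ i, f i = ⊤ := by
  classical
  rw [← Finset.add_sum_erase _ _ (Finset.mem_univ a), ha]
  exact EReal.top_add_of_ne_bot (EReal_sum_ne_bot _ fun i _ => h i)

theorem relEntropy_eq_coe {y : Arr K} (hy : ∀ i l, y i l ≠ 0 → μ i {l} ≠ 0) :
    relEntropy μ y = (relEntropyReal μ y : EReal) := by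
  simp only [relEntropy, relEntropyReal, EReal_coe_sum]
  refine Finset.sum_congr rfl fun i _ => Finset.sum_congr rfl fun l _ => ?_
  by_cases h : y i l = 0
  · simp [h]
  · rw [if_neg h, if_neg (hy i l h), refWeights]

theorem relEntropy_eq_top {y : Arr K} {i : Fin n} {l : Fin (K i)} (hy : y i l ≠ 0)
    (hμ : μ i {l} = 0) : relEntropy μ y = ⊤ := by
  have hterm : ∀ i l, (if y i l = 0 then (0 : EReal) else if μ i {l} = 0 then (⊤ : EReal)
    else ((y i l * Real.log (y i l / (μ i).real {l}) : ℝ) : EReal)) ≠ ⊥ := by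
    intro i l
    split_ifs
    exacts [EReal.zero_ne_bot, top_ne_bot, EReal.coe_ne_bot _]
  refine EReal_sum_eq_top (fun i => EReal_sum_ne_bot _ fun l _ => hterm i l) (a := i) ?_
  exact EReal_sum_eq_top (hterm i) (a := l) (by rw [if_neg hy, if_pos hμ])

theorem refWeights_nonneg (i : Fin n) (l : Fin (K i)) : 0 ≤ refWeights μ i l := measureReal_nonneg

theorem fitted_ne_zero_imp (F : Arr K → ℝ) (x : Arr K) (i : Fin n) (l : Fin (K i))
    (h : fitted (refWeights μ) F x i l ≠ 0) : μ i {l} ≠ 0 := by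
  intro h0
  apply h
  simp [fitted, rowGibbs, refWeights, Measure.real, h0]

variable [∀ i, IsProbabilityMeasure (μ i)]

theorem sum_refWeights (i : Fin n) : ∑ l, refWeights μ i l = 1 := by
  simp only [refWeights]
  rw [sum_measureReal_singleton]
  simp

theorem refWeights_ne_zero {i : Fin n} {l : Fin (K i)} (h : μ i {l} ≠ 0) : refWeights μ i l ≠ 0 :=
  (measureReal_ne_zero_iff).2 h

theorem pi_real_singleton (z : Loc K) :
    (Measure.pi μ).real {z} = ∏ i, refWeights μ i (z i) := by
  simp only [Measure.real, refWeights, Measure.pi_singleton, ENNReal.toReal_prod]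

/-- A crude bound suffices, since it serves only to keep `supFI` below `⊤`. -/
theorem neg_card_le_relEntropyReal {y : Arr K} (hy : y ∈ relaxed K)
    (hyμ : ∀ i l, y i l ≠ 0 → μ i {l} ≠ 0) : (-n : ℝ) ≤ relEntropyReal μ y := by
  have h1 : ∀ i l, y i l - refWeights μ i l - y i l ≤
      y i l * Real.log (y i l / refWeights μ i l) + 0 := by
    intro i l
    have hw0 := refWeights_nonneg (μ := μ) i l
    rcases (hy.1 i l).1.eq_or_lt with h | h
    · rw [← h]; simpa using hw0
    · have hw : 0 < refWeights μ i l := hw0.lt_of_ne' (refWeights_ne_zero (hyμ i l h.ne'))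
      have := mul_le_mul_of_nonneg_left (Real.one_sub_inv_le_log_of_pos (div_pos h hw)) h.le
      have e : y i l * (1 - (y i l / refWeights μ i l)⁻¹) = y i l - refWeights μ i l := by
        field_simp
      rw [e] at this
      linarith
  calc (-n : ℝ) = ∑ i : Fin n, ∑ l, (y i l - refWeights μ i l - y i l) := by
        simp [sum_refWeights]
    _ ≤ _ := Finset.sum_le_sum fun i _ => Finset.sum_le_sum fun l _ => by simpa using h1 i l

/-- The log-density of a fitted row with respect to its reference measure is the increment minus its
log-Laplace value. -/
theorem relEntropyReal_fitted (F : Arr K → ℝ) (x : Arr K) :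
    relEntropyReal μ (fitted (refWeights μ) F x) = ∑ i, ∑ l, fitted (refWeights μ) F x i l *
      (rowIncr F x i l - logLaplace (refWeights μ i) (rowIncr F x i)) := by
  refine Finset.sum_congr rfl fun i _ => Finset.sum_congr rfl fun l _ => ?_
  by_cases h : fitted (refWeights μ) F x i l = 0
  · rw [h, zero_mul, zero_mul]
  · have hw := refWeights_ne_zero (fitted_ne_zero_imp F x i l h)
    congr 1
    rw [fitted, rowGibbs_eq (refWeights_nonneg i) (sum_refWeights i), mul_div_cancel_left₀ _ hw,
      Real.log_exp]

end Entropy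

/-! ### The posterior and the mean-field family expressed through `ν ⊗ μ`. -/

section Model

variable {m n : ℕ} {d : Fin m → ℕ} {K : Fin n → ℕ}
  {ν : ∀ j : Fin m, Measure (EuclideanSpace ℝ (Fin (d j)))} {μ : ∀ i : Fin n, Measure (Fin (K i))}
  {r₀ : Loc K → ℝ} {r : ∀ j : Fin m, EuclideanSpace ℝ (Fin (d j)) → Loc K → ℝ}
  {R₀ : Arr K → ℝ} {R : ∀ j : Fin m, EuclideanSpace ℝ (Fin (d j)) → Arr K → ℝ}
  {F : Arr K → ℝ}

theorem measurable_splitSum {α : Type} {g₀ : α → ℝ}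
    {g : ∀ j : Fin m, EuclideanSpace ℝ (Fin (d j)) → α → ℝ} {a : α}
    (hg : ∀ j, Measurable fun x => g j x a) : Measurable fun θ => splitSum g₀ g θ a :=
  (Finset.measurable_sum _ fun j _ => (hg j).comp (measurable_pi_apply j)).const_add _

theorem collapsedHam_eq (h₂ : HamiltonianExtension r₀ r R₀ R) (h₃ : CollapsedExtension ν R₀ R F)
    (z : Loc K) : collapsedHam ν r₀ r z = F (oneHot z) := by
  rw [h₃.eq_log _ (oneHot_mem_relaxed z), collapsedHam]
  simp only [h₂.extend]

theorem partitionFn_eq [∀ i, IsProbabilityMeasure (μ i)] (h₂ : HamiltonianExtension r₀ r R₀ R)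
    (h₃ : CollapsedExtension ν R₀ R F) :
    partitionFn ν μ r₀ r = ∑ z, gibbsWeight (refWeights μ) F z := by
  simp only [partitionFn, gibbsWeight, collapsedHam_eq h₂ h₃, pi_real_singleton]

theorem partitionFn_pos [∀ i, IsProbabilityMeasure (μ i)] (h₂ : HamiltonianExtension r₀ r R₀ R)
    (h₃ : CollapsedExtension ν R₀ R F) : 0 < partitionFn ν μ r₀ r := by
  rw [partitionFn_eq h₂ h₃]
  exact sum_gibbsWeight_pos refWeights_nonneg sum_refWeights F

theorem integrable_exp_ham (h₂ : HamiltonianExtension r₀ r R₀ R)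
    (h₃ : CollapsedExtension ν R₀ R F) (z : Loc K) :
    Integrable (fun θ => Real.exp (splitSum r₀ r θ z)) (Measure.pi ν) := by
  simpa only [h₂.extend] using h₃.integrable _ (oneHot_mem_relaxed z)

theorem measurable_ham (hr : ∀ j z, Measurable fun x => r j x z) :
    Measurable fun x : Glob d × Loc K => splitSum r₀ r x.1 x.2 :=
  measurable_from_prod_countable_left fun z => measurable_splitSum fun j => hr j z

section

variable [∀ j, IsProbabilityMeasure (ν j)]

theorem integral_exp_splitSum (h₃ : CollapsedExtension ν R₀ R F) {y : Arr K} (hy : y ∈ relaxed K) :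
    ∫ θ, Real.exp (splitSum R₀ R θ y) ∂(Measure.pi ν) = Real.exp (F y) := by
  rw [h₃.eq_log y hy, Real.exp_log (integral_exp_pos (h₃.integrable y hy))]

theorem integral_exp_ham (h₂ : HamiltonianExtension r₀ r R₀ R)
    (h₃ : CollapsedExtension ν R₀ R F) (z : Loc K) :
    ∫ θ, Real.exp (splitSum r₀ r θ z) ∂(Measure.pi ν) = Real.exp (F (oneHot z)) := by
  rw [← integral_exp_splitSum h₃ (oneHot_mem_relaxed z)]
  simp only [h₂.extend]

variable [∀ i, IsProbabilityMeasure (μ i)]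

theorem lintegral_exp_ham (hr : ∀ j z, Measurable fun x => r j x z)
    (h₂ : HamiltonianExtension r₀ r R₀ R) (h₃ : CollapsedExtension ν R₀ R F) :
    ∫⁻ x, ENNReal.ofReal (Real.exp (splitSum r₀ r x.1 x.2)) ∂((Measure.pi ν).prod (Measure.pi μ)) =
      ENNReal.ofReal (partitionFn ν μ r₀ r) := by
  rw [lintegral_prod_fintype (measurable_ham hr).exp fun x => (Real.exp_pos _).le,
    ← ofReal_integral_eq_lintegral_ofReal
      (integrable_finsetSum _ fun z _ => (integrable_exp_ham h₂ h₃ z).const_mul _)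
      (Filter.Eventually.of_forall fun θ => Finset.sum_nonneg fun z _ =>
        mul_nonneg measureReal_nonneg (Real.exp_pos _).le),
    integral_finsetSum _ fun z _ => (integrable_exp_ham h₂ h₃ z).const_mul _]
  congr 1
  refine Finset.sum_congr rfl fun z _ => ?_
  rw [integral_const_mul, integral_exp_ham h₂ h₃, collapsedHam_eq h₂ h₃, mul_comm]

theorem BayesModel.posterior_univ (B : BayesModel d K) : B.posterior Set.univ = 1 := by
  rw [posterior, withDensity_apply _ MeasurableSet.univ, Measure.restrict_univ]
  simp only [div_eq_mul_inv]
  refine (lintegral_mul_const (f := fun x => B.prior x * B.lik x) _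
    (B.measurable_prior.mul B.measurable_lik)).trans ?_
  exact ENNReal.mul_inv_cancel B.evidence_ne_zero B.evidence_ne_top

/-- The unknown proportionality constant is forced by the total mass of the posterior. -/
theorem posterior_eq_withDensity {B : BayesModel d K} (h₁ : FactorizedPosterior B.posterior ν μ r₀ r)
    (h₂ : HamiltonianExtension r₀ r R₀ R) (h₃ : CollapsedExtension ν R₀ R F) :
    B.posterior = ((Measure.pi ν).prod (Measure.pi μ)).withDensity
      fun x => ENNReal.ofReal (Real.exp (splitSum r₀ r x.1 x.2) / partitionFn ν μ r₀ r) := by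
  obtain ⟨c, hc⟩ := h₁.density
  have hS := partitionFn_pos (μ := μ) h₂ h₃
  have h1 : c * ENNReal.ofReal (partitionFn ν μ r₀ r) = 1 := by
    rw [← lintegral_exp_ham h₁.measurable h₂ h₃, ← B.posterior_univ, hc, Measure.smul_apply,
      withDensity_apply _ MeasurableSet.univ, Measure.restrict_univ, smul_eq_mul]
  have hc' : c = (ENNReal.ofReal (partitionFn ν μ r₀ r))⁻¹ := ENNReal.eq_inv_of_mul_eq_one_left h1
  rw [hc, ← withDensity_smul _ (measurable_ham h₁.measurable).exp.ennreal_ofReal, hc']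
  congr 1
  ext x
  rw [Pi.smul_apply, smul_eq_mul, ENNReal.ofReal_div_of_pos hS, mul_comm, div_eq_mul_inv]

/-- The posterior density is strictly positive, so `ν ⊗ μ` is dominated by the posterior, which is
dominated by the base measure. -/
theorem prod_absolutelyContinuous_base {B : BayesModel d K}
    (h₁ : FactorizedPosterior B.posterior ν μ r₀ r)
    (h₂ : HamiltonianExtension r₀ r R₀ R) (h₃ : CollapsedExtension ν R₀ R F) :
    (Measure.pi ν).prod (Measure.pi μ) ≪ B.base := by
  have hS := partitionFn_pos (μ := μ) h₂ h₃
  refine Measure.AbsolutelyContinuous.trans (withDensity_absolutelyContinuous'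
    ((measurable_ham (r₀ := r₀) h₁.measurable).exp.div_const
      (partitionFn ν μ r₀ r)).ennreal_ofReal.aemeasurable
    (Filter.Eventually.of_forall fun x =>
      (ENNReal.ofReal_pos.2 (div_pos (Real.exp_pos _) hS)).ne')) ?_
  rw [← posterior_eq_withDensity h₁ h₂ h₃]
  exact withDensity_absolutelyContinuous _ _

theorem glob_absolutelyContinuous {B : BayesModel d K}
    (h : (Measure.pi ν).prod (Measure.pi μ) ≪ B.base) (j : Fin m) : ν j ≪ B.baseG j := by
  have := B.sigmaFiniteG
  have := B.sigmaFiniteL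
  refine Measure.AbsolutelyContinuous.mk fun s hs h0 => ?_
  have h1 : B.base ((fun x : Glob d × Loc K => x.1 j) ⁻¹' s) = 0 :=
    ((Measure.quasiMeasurePreserving_eval B.baseG j).comp
      (Measure.quasiMeasurePreserving_fst (μ := Measure.pi B.baseG)
        (ν := Measure.pi B.baseL))).preimage_null h0
  rw [← ((measurePreserving_eval ν j).comp (measurePreserving_fst (μ := Measure.pi ν)
    (ν := Measure.pi μ))).measure_preimage hs.nullMeasurableSet]
  exact h h1

theorem loc_absolutelyContinuous {B : BayesModel d K}
    (h : (Measure.pi ν).prod (Measure.pi μ) ≪ B.base) (i : Fin n) : μ i ≪ B.baseL i := by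
  have := B.sigmaFiniteG
  have := B.sigmaFiniteL
  refine Measure.AbsolutelyContinuous.mk fun s hs h0 => ?_
  have h1 : B.base ((fun x : Glob d × Loc K => x.2 i) ⁻¹' s) = 0 :=
    ((Measure.quasiMeasurePreserving_eval B.baseL i).comp
      (Measure.quasiMeasurePreserving_snd (μ := Measure.pi B.baseG)
        (ν := Measure.pi B.baseL))).preimage_null h0
  rw [← ((measurePreserving_eval μ i).comp (measurePreserving_snd (μ := Measure.pi ν)
    (ν := Measure.pi μ))).measure_preimage hs.nullMeasurableSet]
  exact h h1

/-- Multiplying by the Radon-Nikodym derivatives of the factors turns densities relative to `ν_j`,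
`μ_i` into densities relative to the base measures, as `meanField` demands. -/
theorem mem_meanField_of_withDensity {B : BayesModel d K}
    (h : (Measure.pi ν).prod (Measure.pi μ) ≪ B.base)
    {q : ∀ j : Fin m, EuclideanSpace ℝ (Fin (d j)) → ℝ≥0∞} {p : ∀ i : Fin n, Fin (K i) → ℝ≥0∞}
    (hq : ∀ j, Measurable (q j)) (hq1 : ∀ j, ∫⁻ x, q j x ∂(ν j) = 1)
    (hp : ∀ i, ∫⁻ l, p i l ∂(μ i) = 1) :
    ((Measure.pi ν).prod (Measure.pi μ)).withDensity
      (fun x => (∏ j, q j (x.1 j)) * ∏ i, p i (x.2 i)) ∈ B.meanField := by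
  have := B.sigmaFiniteG
  have := B.sigmaFiniteL
  have hpm : ∀ i, Measurable (p i) := fun i => measurable_of_finite _
  have hqm : Measurable fun θ : Glob d => ∏ j, q j (θ j) :=
    Finset.measurable_prod _ fun j _ => (hq j).comp (measurable_pi_apply j)
  have hG : ∀ j, (B.baseG j).withDensity ((ν j).rnDeriv (B.baseG j) * q j) =
      (ν j).withDensity (q j) := fun j => by
    rw [withDensity_mul _ (Measure.measurable_rnDeriv _ _) (hq j),
      Measure.withDensity_rnDeriv_eq _ _ (glob_absolutelyContinuous h j)]
  have hL : ∀ i, (B.baseL i).withDensity ((μ i).rnDeriv (B.baseL i) * p i) =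
      (μ i).withDensity (p i) := fun i => by
    rw [withDensity_mul _ (Measure.measurable_rnDeriv _ _) (hpm i),
      Measure.withDensity_rnDeriv_eq _ _ (loc_absolutelyContinuous h i)]
  have htot : ∀ {α : Type} [MeasurableSpace α] (κ κ' : Measure α) (f g : α → ℝ≥0∞),
      κ.withDensity f = κ'.withDensity g → ∫⁻ x, f x ∂κ = ∫⁻ x, g x ∂κ' := by
    intro α _ κ κ' f g h
    rw [← setLIntegral_univ f, ← setLIntegral_univ g, ← withDensity_apply _ MeasurableSet.univ, h,
      withDensity_apply _ MeasurableSet.univ]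
  refine ⟨fun j => (ν j).rnDeriv (B.baseG j) * q j, fun i => (μ i).rnDeriv (B.baseL i) * p i,
    fun j => ⟨(Measure.measurable_rnDeriv _ _).mul (hq j), ?_⟩,
    fun i => ⟨measurable_of_finite _, ?_⟩, ?_⟩
  · rw [htot _ _ _ _ (hG j), hq1]
  · rw [htot _ _ _ _ (hL i), hp]
  · simp only [hG, hL]
    rw [pi_withDensity ν hq hq1, pi_withDensity μ hpm hp]
    have : IsProbabilityMeasure ((Measure.pi μ).withDensity fun z => ∏ i, p i (z i)) :=
      isProbabilityMeasure_withDensity (by rw [lintegral_pi_prod μ hpm]; simp [hp])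
    rw [prod_withDensity hqm (measurable_of_finite _)]

end

end Model

end MeanFieldVI

namespace MeanFieldVI

/-! ### The competitor, its divergence, and the variational optimum. -/

section Bounds

variable {m n : ℕ} {d : Fin m → ℕ} {K : Fin n → ℕ}
  {ν : ∀ j : Fin m, Measure (EuclideanSpace ℝ (Fin (d j)))} {μ : ∀ i : Fin n, Measure (Fin (K i))}
  {r₀ : Loc K → ℝ} {r : ∀ j : Fin m, EuclideanSpace ℝ (Fin (d j)) → Loc K → ℝ}
  {R₀ : Arr K → ℝ} {R : ∀ j : Fin m, EuclideanSpace ℝ (Fin (d j)) → Arr K → ℝ}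
  {F : Arr K → ℝ}

/-- Density, with respect to `ν ⊗ μ`, of the mean-field distribution with local marginals `y`
and global marginals proportional to `exp R_j(·, y)`. -/
noncomputable def candidateDensity (μ : ∀ i : Fin n, Measure (Fin (K i))) (R₀ : Arr K → ℝ)
    (R : ∀ j : Fin m, EuclideanSpace ℝ (Fin (d j)) → Arr K → ℝ) (F : Arr K → ℝ) (y : Arr K)
    (x : Glob d × Loc K) : ℝ :=
  Real.exp (splitSum R₀ R x.1 y - F y) * ∏ i, y i (x.2 i) / refWeights μ i (x.2 i)

theorem measurable_candidateDensity (h₂ : HamiltonianExtension r₀ r R₀ R) {y : Arr K}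
    (hy : y ∈ relaxed K) : Measurable (candidateDensity μ R₀ R F y) :=
  (((measurable_splitSum fun j => h₂.measurable j y hy).sub_const (F y)).exp.comp
    measurable_fst).mul ((measurable_of_finite fun z : Loc K =>
      ∏ i, y i (z i) / refWeights μ i (z i)).comp measurable_snd)

theorem candidateDensity_nonneg {y : Arr K} (hy : y ∈ relaxed K) (x : Glob d × Loc K) :
    0 ≤ candidateDensity μ R₀ R F y x :=
  mul_nonneg (Real.exp_pos _).le
    (Finset.prod_nonneg fun i _ => div_nonneg (hy.1 i _).1 (refWeights_nonneg i _))

variable [∀ j, IsProbabilityMeasure (ν j)] [∀ i, IsProbabilityMeasure (μ i)]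

omit [∀ j, IsProbabilityMeasure (ν j)] in
theorem real_mul_candidateDensity {y : Arr K} (hyμ : ∀ i l, y i l ≠ 0 → μ i {l} ≠ 0)
    (θ : Glob d) (z : Loc K) :
    (Measure.pi μ).real {z} * candidateDensity μ R₀ R F y (θ, z) =
      Real.exp (splitSum R₀ R θ y - F y) * ∏ i, y i (z i) := by
  rw [pi_real_singleton, candidateDensity, mul_left_comm, ← Finset.prod_mul_distrib]
  congr 1
  refine Finset.prod_congr rfl fun i _ => ?_
  by_cases h : y i (z i) = 0
  · simp [h]
  · exact mul_div_cancel₀ _ (refWeights_ne_zero (hyμ i _ h))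

theorem candidate_mem_meanField {B : BayesModel d K}
    (hac : (Measure.pi ν).prod (Measure.pi μ) ≪ B.base)
    (h₂ : HamiltonianExtension r₀ r R₀ R) (h₃ : CollapsedExtension ν R₀ R F) {y : Arr K}
    (hy : y ∈ relaxed K) (hyμ : ∀ i l, y i l ≠ 0 → μ i {l} ≠ 0) :
    ((Measure.pi ν).prod (Measure.pi μ)).withDensity
      (fun x => ENNReal.ofReal (candidateDensity μ R₀ R F y x)) ∈ B.meanField := by
  set f : ∀ j : Fin m, EuclideanSpace ℝ (Fin (d j)) → ℝ≥0∞ :=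
    fun j x => ENNReal.ofReal (Real.exp (R j x y)) with hf
  have hfm : ∀ j, Measurable (f j) := fun j => (h₂.measurable j y hy).exp.ennreal_ofReal
  set N : Fin m → ℝ≥0∞ := fun j => ∫⁻ x, f j x ∂(ν j) with hN
  have hprod : ∀ θ : Glob d, ∏ j, f j (θ j) =
      ENNReal.ofReal (Real.exp (splitSum R₀ R θ y)) * ENNReal.ofReal (Real.exp (-R₀ y)) := by
    intro θ
    rw [← ENNReal.ofReal_mul (Real.exp_pos _).le, ← Real.exp_add, splitSum,
      ← ENNReal.ofReal_prod_of_nonneg fun j _ => (Real.exp_pos _).le, ← Real.exp_sum]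
    congr 2; ring
  have hprodN : ∏ j, N j = ENNReal.ofReal (Real.exp (F y - R₀ y)) := by
    rw [hN, ← lintegral_pi_prod ν hfm]
    simp only [hprod]
    rw [lintegral_mul_const' _ _ ENNReal.ofReal_ne_top,
      ← ofReal_integral_eq_lintegral_ofReal (h₃.integrable y hy)
        (Filter.Eventually.of_forall fun θ => (Real.exp_pos _).le),
      integral_exp_splitSum h₃ hy, ← ENNReal.ofReal_mul (Real.exp_pos _).le, ← Real.exp_add,
      sub_eq_add_neg]
  have hN0 : ∀ j, N j ≠ 0 := fun j hj => by
    have := Finset.prod_eq_zero (Finset.mem_univ j) hj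
    rw [hprodN] at this
    exact (ENNReal.ofReal_pos.2 (Real.exp_pos _)).ne' this
  -- Only the product of the normalizers is known to be finite; since none vanishes, an infinite one
  -- would make the product infinite.
  have hNt : ∀ j, N j ≠ ⊤ := fun j hj => by
    have h := Finset.mul_prod_erase Finset.univ N (Finset.mem_univ j)
    rw [hj, ENNReal.top_mul (Finset.prod_ne_zero_iff.2 fun j _ => hN0 j), hprodN] at h
    exact ENNReal.ofReal_ne_top h.symm
  have hinv : ∏ j, (N j)⁻¹ = ENNReal.ofReal (Real.exp (R₀ y - F y)) := by
    refine ENNReal.eq_inv_of_mul_eq_one_left (b := ∏ j, N j) ?_ |>.trans ?_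
    · rw [← Finset.prod_mul_distrib]
      exact Finset.prod_eq_one fun j _ => ENNReal.inv_mul_cancel (hN0 j) (hNt j)
    · rw [hprodN, ← ENNReal.ofReal_inv_of_pos (Real.exp_pos _), ← Real.exp_neg, neg_sub]
  convert mem_meanField_of_withDensity hac (q := fun j x => f j x * (N j)⁻¹)
    (p := fun i l => ENNReal.ofReal (y i l / refWeights μ i l)) (fun j => (hfm j).mul_const _)
    (fun j => ?_) (fun i => ?_) using 3 with x
  · rw [Finset.prod_mul_distrib, hprod, hinv, candidateDensity,
      ENNReal.ofReal_mul (Real.exp_pos _).le, ENNReal.ofReal_prod_of_nonneg fun i _ =>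
        div_nonneg (hy.1 i _).1 (refWeights_nonneg i _), mul_assoc,
      ← ENNReal.ofReal_mul (Real.exp_pos _).le, ← Real.exp_add, ← mul_assoc,
      ← ENNReal.ofReal_mul (Real.exp_pos _).le, ← Real.exp_add]
    congr 3; ring
  · rw [lintegral_mul_const _ (hfm j)]
    exact ENNReal.mul_inv_cancel (hN0 j) (hNt j)
  · rw [lintegral_fintype]
    have : ∀ l, ENNReal.ofReal (y i l / refWeights μ i l) * μ i {l} = ENNReal.ofReal (y i l) := by
      intro l
      rw [← ofReal_measureReal (μ := μ i) (s := {l}),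
        ← ENNReal.ofReal_mul (div_nonneg (hy.1 i l).1 (refWeights_nonneg i l))]
      congr 1
      by_cases h : y i l = 0
      · simp [h]
      · exact div_mul_cancel₀ _ (refWeights_ne_zero (hyμ i l h))
    simp only [this]
    rw [← ENNReal.ofReal_sum_of_nonneg fun l _ => (hy.1 i l).1, hy.2 i, ENNReal.ofReal_one]

/-- Variational upper bound for the divergence of the variational posterior. -/
theorem klDiv_variationalPosterior_le {B : BayesModel d K}
    (h₁ : FactorizedPosterior B.posterior ν μ r₀ r)
    (h₂ : HamiltonianExtension r₀ r R₀ R) (h₃ : CollapsedExtension ν R₀ R F)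
    {P : Measure (Glob d × Loc K)} (hP : B.IsVariationalPosterior P) {e : Fin n → ℝ}
    (he : ∀ θ ∈ (Measure.pi ν).support, ∀ i l l', ∀ y ∈ cube K,
      |pderiv2 (splitSum R₀ R θ) i l i l' y| ≤ e i) {y : Arr K}
    (hy : y ∈ relaxed K) (hyμ : ∀ i l, y i l ≠ 0 → μ i {l} ≠ 0) :
    0 ≤ Real.log (partitionFn ν μ r₀ r) - (F y - relEntropyReal μ y) + 2 * ∑ i, e i ∧
    klDiv P B.posterior ≤ ENNReal.ofReal
      (Real.log (partitionFn ν μ r₀ r) - (F y - relEntropyReal μ y) + 2 * ∑ i, e i) := by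
  have hS := partitionFn_pos (μ := μ) h₂ h₃
  have hac := prod_absolutelyContinuous_base h₁ h₂ h₃
  have hmass : ∀ θ : Glob d, ∑ z, (Measure.pi μ).real {z} * candidateDensity μ R₀ R F y (θ, z) =
      Real.exp (splitSum R₀ R θ y - F y) := fun θ => by
    simp only [real_mul_candidateDensity hyμ, ← Finset.mul_sum, sum_prod_eq_one hy, mul_one]
  have hint : ∫⁻ θ, ENNReal.ofReal (Real.exp (splitSum R₀ R θ y - F y)) ∂(Measure.pi ν) = 1 := by
    have hi : Integrable (fun θ => Real.exp (splitSum R₀ R θ y - F y)) (Measure.pi ν) := by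
      simpa only [Real.exp_sub] using (h₃.integrable y hy).div_const _
    rw [← ofReal_integral_eq_lintegral_ofReal hi
      (Filter.Eventually.of_forall fun θ => (Real.exp_pos _).le)]
    simp only [Real.exp_sub, integral_div]
    rw [integral_exp_splitSum h₃ hy, div_self (Real.exp_pos _).ne', ENNReal.ofReal_one]
  have key := klDiv_withDensity_le (ν := Measure.pi ν) (π := Measure.pi μ)
    (ρ := fun x => Real.exp (splitSum r₀ r x.1 x.2) / partitionFn ν μ r₀ r)
    (γ := candidateDensity μ R₀ R F y)
    (B := Real.log (partitionFn ν μ r₀ r) - (F y - relEntropyReal μ y) + 2 * ∑ i, e i)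
    ((measurable_ham h₁.measurable).exp.div_const _) (measurable_candidateDensity h₂ hy)
    (fun x => div_pos (Real.exp_pos _) hS) (candidateDensity_nonneg hy)
    (by
      rw [← setLIntegral_univ, ← withDensity_apply _ MeasurableSet.univ,
        ← posterior_eq_withDensity h₁ h₂ h₃, B.posterior_univ])
    (by
      rw [lintegral_prod_fintype (measurable_candidateDensity h₂ hy) (candidateDensity_nonneg hy)]
      simp only [hmass, hint])
    (by
      -- The Hessian bound on `R` is available only on the support of `ν`, which has full measure.
      filter_upwards [Measure.support_mem_ae (μ := Measure.pi ν)] with θ hθ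
      rw [hmass]
      have hterm : ∀ z, (Measure.pi μ).real {z} * (candidateDensity μ R₀ R F y (θ, z) *
          Real.log (candidateDensity μ R₀ R F y (θ, z) /
            (Real.exp (splitSum r₀ r θ z) / partitionFn ν μ r₀ r))) =
          Real.exp (splitSum R₀ R θ y - F y) * ((∏ i, y i (z i)) *
            (splitSum R₀ R θ y - F y + Real.log (partitionFn ν μ r₀ r)) +
            (∏ i, y i (z i)) * (∑ i, Real.log (y i (z i) / refWeights μ i (z i))) -
            (∏ i, y i (z i)) * splitSum R₀ R θ (oneHot z)) := by
        intro z
        rw [← mul_assoc, real_mul_candidateDensity hyμ, h₂.extend]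
        by_cases h : ∏ i, y i (z i) = 0
        · simp [h]
        · have hyi : ∀ i, y i (z i) ≠ 0 := fun i => Finset.prod_ne_zero_iff.1 h i (Finset.mem_univ i)
          have hyw : ∀ i, y i (z i) / refWeights μ i (z i) ≠ 0 := fun i =>
            div_ne_zero (hyi i) (refWeights_ne_zero (hyμ i _ (hyi i)))
          have hp0 : ∏ i, y i (z i) / refWeights μ i (z i) ≠ 0 :=
            Finset.prod_ne_zero_iff.2 fun i _ => hyw i
          have hc0 : candidateDensity μ R₀ R F y (θ, z) ≠ 0 :=
            mul_ne_zero (Real.exp_pos _).ne' hp0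
          rw [Real.log_div hc0 (div_pos (Real.exp_pos _) hS).ne',
            Real.log_div (Real.exp_pos _).ne' hS.ne', Real.log_exp, candidateDensity,
            Real.log_mul (Real.exp_pos _).ne' hp0, Real.log_exp,
            Real.log_prod fun i _ => hyw i]
          ring
      simp only [hterm]
      rw [← Finset.mul_sum, Finset.sum_sub_distrib, Finset.sum_add_distrib, ← Finset.sum_mul,
        sum_prod_eq_one hy, sum_prod_mul_sum hy fun i l => Real.log (y i l / refWeights μ i l),
        ← relEntropyReal, mul_comm]
      refine mul_le_mul_of_nonneg_right ?_ (Real.exp_pos _).le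
      have := le_sum_prod_mul_oneHot (h₂.contDiffOn θ) (he θ hθ) hy
      linarith)
  refine ⟨key.1, (hP.2 _ (candidate_mem_meanField hac h₂ h₃ hy hyμ)).trans ?_⟩
  rw [posterior_eq_withDensity h₁ h₂ h₃]
  exact key.2

omit [∀ j, IsProbabilityMeasure (ν j)] in
theorem hessRTerm_bound (h : hessRTerm ν R₀ R ≠ ⊤) :
    ∃ e : Fin n → ℝ, hessRTerm ν R₀ R = ENNReal.ofReal (2 * ∑ i, e i) ∧ (∀ i, 0 ≤ e i) ∧
      ∀ θ ∈ (Measure.pi ν).support, ∀ i l l', ∀ y ∈ cube K,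
        |pderiv2 (splitSum R₀ R θ) i l i l' y| ≤ e i := by
  set a : Fin n → ℝ≥0∞ := fun i => ⨆ (l : Fin (K i)) (l' : Fin (K i)), hessR ν R₀ R i l i l' with ha
  have hsum : ∑ i, a i ≠ ⊤ := fun h' => h (by rw [hessRTerm, h', ENNReal.mul_top two_ne_zero])
  have hat : ∀ i, a i ≠ ⊤ := fun i => ENNReal.sum_ne_top.1 hsum i (Finset.mem_univ i)
  refine ⟨fun i => (a i).toReal, ?_, fun i => ENNReal.toReal_nonneg, ?_⟩
  · rw [← ENNReal.toReal_sum fun i _ => hat i, ENNReal.ofReal_mul zero_le_two,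
      ENNReal.ofReal_toReal hsum, hessRTerm, ENNReal.ofReal_ofNat]
  · intro θ hθ i l l' y hy
    rw [← ENNReal.ofReal_le_iff_le_toReal (hat i)]
    have h1 : ENNReal.ofReal |pderiv2 (splitSum R₀ R θ) i l i l' y| ≤ hessR ν R₀ R i l i l' :=
      (le_iSup₂ (f := fun y (_ : y ∈ cube K) =>
        ENNReal.ofReal |pderiv2 (splitSum R₀ R θ) i l i l' y|) y hy).trans
      (le_iSup₂ (f := fun θ (_ : θ ∈ (Measure.pi ν).support) => ⨆ y ∈ cube K,
        ENNReal.ofReal |pderiv2 (splitSum R₀ R θ) i l i l' y|) θ hθ)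
    exact h1.trans (le_iSup₂ (f := fun l l' => hessR ν R₀ R i l i l') l l')

omit [∀ j, IsProbabilityMeasure (ν j)] in
/-- The variational optimum `sup (F - I)` is a real number, within the smoothness and complexity
terms of the log-partition function. -/
theorem exists_supFI_eq (h₂ : HamiltonianExtension r₀ r R₀ R) (h₃ : CollapsedExtension ν R₀ R F)
    {ε : ℝ} {D : Finset (Arr K)} (hD : IsGradientNet F ε D) :
    ∃ v : ℝ, supFI μ F = v ∧
      Real.log (partitionFn ν μ r₀ r) ≤ v + (2 * smoothTerm F + complexityTerm ε D) := by
  obtain ⟨z, hz⟩ := exists_log_sum_gibbsWeight_le (w := refWeights μ) refWeights_nonneg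
    sum_refWeights h₃.contDiffOn hD
  rw [← relEntropyReal_fitted, ← partitionFn_eq h₂ h₃] at hz
  set x := fitted (refWeights μ) F (oneHot z) with hx
  have hxr : x ∈ relaxed K := fitted_mem_relaxed refWeights_nonneg sum_refWeights F _
  have hlow : ((F x - relEntropyReal μ x : ℝ) : EReal) ≤ supFI μ F := by
    rw [EReal.coe_sub, ← relEntropy_eq_coe (μ := μ) (y := x) (fitted_ne_zero_imp F _)]
    exact le_iSup₂ (f := fun y (_ : y ∈ relaxed K) => (F y : EReal) - relEntropy μ y) x hxr
  obtain ⟨c, hc⟩ := isCompact_cube.bddAbove_image h₃.contDiffOn.continuousOn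
  have hup : supFI μ F ≤ ((c + n : ℝ) : EReal) := by
    refine iSup₂_le fun y hy => ?_
    by_cases hyμ : ∀ i l, y i l ≠ 0 → μ i {l} ≠ 0
    · rw [relEntropy_eq_coe hyμ, ← EReal.coe_sub, EReal.coe_le_coe_iff]
      linarith [neg_card_le_relEntropyReal hy hyμ, hc ⟨y, hy.1, rfl⟩]
    · push Not at hyμ
      obtain ⟨i, l, h1, h2⟩ := hyμ
      rw [relEntropy_eq_top h1 h2, EReal.sub_top]
      exact bot_le
  have hnt : supFI μ F ≠ ⊤ := (hup.trans_lt (EReal.coe_lt_top _)).ne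
  have hnb : supFI μ F ≠ ⊥ := ((EReal.bot_lt_coe _).trans_le hlow).ne'
  refine ⟨(supFI μ F).toReal, (EReal.coe_toReal hnt hnb).symm, ?_⟩
  have := EReal.toReal_le_toReal hlow (EReal.coe_ne_bot _) hnt
  rw [EReal.toReal_coe] at this
  linarith

/-- Optimizes the competitor over `y`; arrays not dominated by `μ` contribute `⊥` to the supremum
and are harmless. -/
theorem klDiv_le_log_sub_supFI {B : BayesModel d K}
    (h₁ : FactorizedPosterior B.posterior ν μ r₀ r)
    (h₂ : HamiltonianExtension r₀ r R₀ R) (h₃ : CollapsedExtension ν R₀ R F)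
    {P : Measure (Glob d × Loc K)} (hP : B.IsVariationalPosterior P) {v : ℝ}
    (hv : supFI μ F = v) :
    ((klDiv P B.posterior : ℝ≥0∞) : EReal) ≤
      ((Real.log (partitionFn ν μ r₀ r) - v : ℝ) : EReal) +
        ((hessRTerm ν R₀ R : ℝ≥0∞) : EReal) := by
  by_cases htop : hessRTerm ν R₀ R = ⊤
  · rw [htop, EReal.coe_ennreal_top, EReal.coe_add_top]; exact le_top
  obtain ⟨e, he, he0, hb⟩ := hessRTerm_bound htop
  have he2 : 0 ≤ 2 * ∑ i, e i := mul_nonneg zero_le_two (Finset.sum_nonneg fun i _ => he0 i)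
  rw [he, EReal.coe_ennreal_ofReal, max_eq_left he2, ← EReal.coe_add]
  have hmain : ∀ y ∈ relaxed K, (∀ i l, y i l ≠ 0 → μ i {l} ≠ 0) →
      ((klDiv P B.posterior : ℝ≥0∞) : EReal) ≤
        ((Real.log (partitionFn ν μ r₀ r) - (F y - relEntropyReal μ y) + 2 * ∑ i, e i : ℝ) :
          EReal) := by
    intro y hy hyμ
    obtain ⟨h0, h⟩ := klDiv_variationalPosterior_le h₁ h₂ h₃ hP hb hy hyμ
    refine (EReal.coe_ennreal_le_coe_ennreal_iff.2 h).trans_eq ?_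
    rw [EReal.coe_ennreal_ofReal, max_eq_left h0]
  have hw : ∀ i l, refWeights μ i l ≠ 0 → μ i {l} ≠ 0 := fun i l h => (measureReal_ne_zero_iff).1 h
  -- The reference weights are an admissible competitor, so the divergence is finite and the bounds
  -- can be rearranged in the reals.
  have hwr : refWeights μ ∈ relaxed K :=
    ⟨fun i l => ⟨refWeights_nonneg i l, measureReal_le_one⟩, fun i => sum_refWeights i⟩
  have hkt : ((klDiv P B.posterior : ℝ≥0∞) : EReal) ≠ ⊤ :=
    ((hmain _ hwr hw).trans_lt (EReal.coe_lt_top _)).ne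
  have hkb : ((klDiv P B.posterior : ℝ≥0∞) : EReal) ≠ ⊥ := EReal.coe_ennreal_ne_bot _
  rw [← EReal.coe_toReal hkt hkb] at hmain ⊢
  set k := EReal.toReal ((klDiv P B.posterior : ℝ≥0∞) : EReal)
  have hle : supFI μ F ≤ ((Real.log (partitionFn ν μ r₀ r) + 2 * ∑ i, e i - k : ℝ) : EReal) := by
    refine iSup₂_le fun y hy => ?_
    by_cases hyμ : ∀ i l, y i l ≠ 0 → μ i {l} ≠ 0
    · have := EReal.coe_le_coe_iff.1 (hmain y hy hyμ)
      rw [relEntropy_eq_coe hyμ, ← EReal.coe_sub, EReal.coe_le_coe_iff]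
      linarith
    · push Not at hyμ
      obtain ⟨i, l, h1, h2⟩ := hyμ
      rw [relEntropy_eq_top h1 h2, EReal.sub_top]
      exact bot_le
  rw [hv, EReal.coe_le_coe_iff] at hle
  rw [EReal.coe_le_coe_iff]
  linarith

omit [∀ j, IsProbabilityMeasure (ν j)] [∀ i, IsProbabilityMeasure (μ i)] in
theorem logTerm_nonneg (F : Arr K → ℝ) {t : ℝ} (ht : 0 < t) : 0 ≤ logTerm F t := by
  refine Real.log_nonneg ?_
  have : 0 ≤ (∑ i, ⨆ l : Fin (K i), gradBd F i l) / t := div_nonneg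
    (Finset.sum_nonneg fun i _ => Real.iSup_nonneg fun l => sSup_abs_nonneg _ _) ht.le
  linarith

theorem EReal_coe_add_div (a : ℝ) (e : ℝ≥0∞) {n : ℕ} (hn : 0 < n) :
    (a : EReal) / (n : EReal) + (e : EReal) / (n : EReal) = ((a : EReal) + (e : EReal)) / (n : EReal) := by
  have hn' : (0 : ℝ) < n := Nat.cast_pos.2 hn
  have hnE : (n : EReal) = ((n : ℝ) : EReal) := by norm_cast
  rw [hnE]
  by_cases h : e = ⊤
  · rw [h, EReal.coe_ennreal_top, EReal.coe_add_top,
      EReal.top_div_of_pos_ne_top (by exact_mod_cast hn') (EReal.coe_ne_top _), ← EReal.coe_div,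
      EReal.coe_add_top]
  · lift e to NNReal using h
    rw [EReal.coe_nnreal_eq_coe_real]
    rw [← EReal.coe_add, ← EReal.coe_div, ← EReal.coe_div, ← EReal.coe_div, ← EReal.coe_add, add_div]

end Bounds

end MeanFieldVI

open MeanFieldVI
theorem theorem2p2 :
    ∃ C : ℝ, 0 < C ∧
      ∀ (m n : ℕ) (d : Fin m → ℕ) (K : Fin n → ℕ)
        (_hm : 0 < m) (_hn : 0 < n) (_hd : ∀ j, 0 < d j) (_hK : ∀ i, 0 < K i)
        (B : BayesModel d K)
        (ν : ∀ j : Fin m, Measure (EuclideanSpace ℝ (Fin (d j))))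
        (μ : ∀ i : Fin n, Measure (Fin (K i)))
        (_hν : ∀ j, IsProbabilityMeasure (ν j)) (_hμ : ∀ i, IsProbabilityMeasure (μ i))
        (r₀ : Loc K → ℝ) (r : ∀ j : Fin m, EuclideanSpace ℝ (Fin (d j)) → Loc K → ℝ)
        (R₀ : Arr K → ℝ) (R : ∀ j : Fin m, EuclideanSpace ℝ (Fin (d j)) → Arr K → ℝ)
        (F : Arr K → ℝ)
        (_h₁ : FactorizedPosterior B.posterior ν μ r₀ r)
        (_h₂ : HamiltonianExtension r₀ r R₀ R)
        (_h₃ : CollapsedExtension ν R₀ R F)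
        (P : Measure (Glob d × Loc K)) (_hP : B.IsVariationalPosterior P)
        (ε t : ℝ) (_hε : 0 < ε) (_ht : 0 < t) (_htE : smoothTerm F ≤ t)
        (D : Finset (Arr K)) (_hD : IsGradientNet F ε D),
        ((klDiv P B.posterior : ℝ≥0∞) : EReal) / (n : EReal) ≤
            (((Real.log (partitionFn ν μ r₀ r) : ℝ) : EReal) - supFI μ F) / (n : EReal) +
              ((hessRTerm ν R₀ R : ℝ≥0∞) : EReal) / (n : EReal) ∧
        (((Real.log (partitionFn ν μ r₀ r) : ℝ) : EReal) - supFI μ F) / (n : EReal) +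
              ((hessRTerm ν R₀ R : ℝ≥0∞) : EReal) / (n : EReal) ≤
            (((C * (t + logTerm F t) + complexityTerm ε D : ℝ) : EReal) +
              ((hessRTerm ν R₀ R : ℝ≥0∞) : EReal)) / (n : EReal) := by
  -- The large deviation bound costs `2 * smoothTerm F ≤ 2 * t`; of the logarithmic term only
  -- nonnegativity is needed.
  refine ⟨2, two_pos, ?_⟩
  intro m n d K _hm hn _hd _hK B ν μ hν hμ r₀ r R₀ R F h₁ h₂ h₃ P hP ε t _hε ht htE D hD
  obtain ⟨v, hv, hle⟩ := exists_supFI_eq (μ := μ) h₂ h₃ hD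
  have hn0 : (0 : EReal) ≤ (n : EReal) := by positivity
  rw [hv, ← EReal.coe_sub, EReal_coe_add_div _ _ hn]
  refine ⟨EReal.div_le_div_right_of_nonneg hn0 (klDiv_le_log_sub_supFI h₁ h₂ h₃ hP hv),
    EReal.div_le_div_right_of_nonneg hn0 (add_le_add_left ?_ _)⟩
  rw [EReal.coe_le_coe_iff]
  linarith [logTerm_nonneg F ht]
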